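/- For $m\in\mathbb{N}=\{1,2,3,\dots\}$, a real function $f\in L^1([0,\infty))$ and (almost every) $t\ge 0$ put \[ \Lambda_m f(t)=\frac{1+m}{t^{1+m/2}}\int_0^t f(s)\,s^{m/2}\,ds-f(t),\qquad \Lambda_m^* f(t)=(1+m)\,t^{m/2}\int_t^\infty \frac{f(s)}{s^{1+m/2}}\,ds-f(t). \] For an operator $T$ on $L^1([0,\infty))$ and a class $\mathcal F\subset L^1([0,\infty))$ define the restricted weak-type constant \[ \mathcal{W}(T,\mathcal F)=\sup\Bigl\{\frac{\bigl|\{t\in[0,\infty):|Tf(t)|\ge 1\}\bigr|}{\|f\|_{L^1([0,\infty))}} : f\in\mathcal F,\ \|f\|_{L^1([0,\infty))}\ne 0\Bigr\}, \] where $|\cdot|$ of a set is its Lebesgue measure. Let $\mathcal F_m^{\mathrm{spec}}$ be the class of all functions \[ f(t)=\Bigl(\tfrac{2+m}{m}-\tfrac{2(1+m)}{m}t^{m/2}\Bigr)\mathbf 1_{\{t\in(1,b]\}}+\Bigl(-\tfrac{2+m}{m}+D\,t^{m/2}\Bigr)\mathbf 1_{\{t\in(b,d]\}}, \qquad D=\tfrac{2(1+m)}{m}\bigl(2b^{-m/2}-1\bigr),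 \] with $1<b<d$ such that $D>0$ and $-\frac{2+m}{m}+D\,b^{m/2}<0<-\frac{2+m}{m}+D\,d^{m/2}<2$. Let $\mathcal F_m^{*\mathrm{spec}}$ be the class of all functions \[ f_*(t)=\Bigl(-\tfrac{m}{2+m}+D_*\,t^{-1-m/2}\Bigr)\mathbf 1_{\{t\in(d_*,b_*]\}}+\Bigl(\tfrac{m}{2+m}-\tfrac{2(1+m)}{2+m}t^{-1-m/2}\Bigr)\mathbf 1_{\{t\in(b_*,1]\}}, \qquad D_*=\tfrac{2(1+m)}{2+m}\bigl(2b_*^{1+m/2}-1\bigr), \] with $0<d_*<b_*<1$ such that $D_*>0$ and $2>-\frac{m}{2+m}+D_*\,d_*^{-1-m/2}>0>-\frac{m}{2+m}+D_*\,b_*^{-1-m/2}$. Then for every $m\in\mathbb{N}$, \[ \mathcal{W}\bigl(\Lambda_m^*,\mathcal F_m^{*\mathrm{spec}}\bigr)=\mathcal{W}\bigl(\Lambda_m,\mathcal F_m^{\mathrm{spec}}\bigr). \] -/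

import Mathlib

open MeasureTheory

noncomputable section

/-- The restricted weak-type `(1,1)` constant of an operator `T` over a class `F` of functions on
the half-line `[0, ∞)` (functions on `ℝ` of which only the values on `[0, ∞)` are used): the
supremum of `|{t ∈ [0, ∞) : |T f t| ≥ 1}| / ‖f‖_{L¹([0, ∞))}` over all `f ∈ F` of nonzero norm,
taken in `[0, ∞]`. -/
def weakConstRestricted (T : (ℝ → ℝ) → ℝ → ℝ) (F : Set (ℝ → ℝ)) : ENNReal :=
  ⨆ f ∈ {f : ℝ → ℝ | f ∈ F ∧ (∫⁻ t in Set.Ici (0 : ℝ), ‖f t‖ₑ) ≠ 0},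
    volume {t : ℝ | 0 ≤ t ∧ 1 ≤ |T f t|} / ∫⁻ t in Set.Ici (0 : ℝ), ‖f t‖ₑ

/-- `Λ_m f(t) = (1+m) / t^{1+m/2} ∫_0^t f(s) s^{m/2} ds - f(t)`. -/
def lam (m : ℕ) (f : ℝ → ℝ) (t : ℝ) : ℝ :=
  (1 + (m : ℝ)) / t ^ (1 + (m : ℝ) / 2) * (∫ s in (0 : ℝ)..t, f s * s ^ ((m : ℝ) / 2)) - f t

/-- `Λ_m^* f(t) = (1+m) t^{m/2} ∫_t^∞ f(s) / s^{1+m/2} ds - f(t)`. -/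
def lamStar (m : ℕ) (f : ℝ → ℝ) (t : ℝ) : ℝ :=
  (1 + (m : ℝ)) * t ^ ((m : ℝ) / 2) * (∫ s in Set.Ioi t, f s / s ^ (1 + (m : ℝ) / 2)) - f t

/-- `D(b,m) = (2(1+m)/m) (2 b^{-m/2} - 1)`. -/
def coefD (m : ℕ) (b : ℝ) : ℝ :=
  2 * (1 + (m : ℝ)) / m * (2 * b ^ (-(m : ℝ) / 2) - 1)

/-- `D_*(b_*,m) = (2(1+m)/(2+m)) (2 b_*^{1+m/2} - 1)`. -/
def coefDStar (m : ℕ) (b : ℝ) : ℝ :=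
  2 * (1 + (m : ℝ)) / (2 + m) * (2 * b ^ (1 + (m : ℝ) / 2) - 1)

/-- The function with parameters `b`, `d`:
`((2+m)/m - (2(1+m)/m) t^{m/2})` on `(1,b]`, `(-(2+m)/m + D t^{m/2})` on `(b,d]`, zero elsewhere. -/
def specFun (m : ℕ) (b d : ℝ) (t : ℝ) : ℝ :=
  (Set.Ioc 1 b).indicator
      (fun t : ℝ => (2 + (m : ℝ)) / m - 2 * (1 + (m : ℝ)) / m * t ^ ((m : ℝ) / 2)) t
    + (Set.Ioc b d).indicator
      (fun t : ℝ => -((2 + (m : ℝ)) / m) + coefD m b * t ^ ((m : ℝ) / 2)) t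

/-- The function with parameters `b = b_*`, `d = d_*`:
`(-m/(2+m) + D_* t^{-1-m/2})` on `(d,b]`, `(m/(2+m) - (2(1+m)/(2+m)) t^{-1-m/2})` on `(b,1]`,
zero elsewhere. -/
def specFunStar (m : ℕ) (b d : ℝ) (t : ℝ) : ℝ :=
  (Set.Ioc d b).indicator
      (fun t : ℝ => -((m : ℝ) / (2 + m)) + coefDStar m b * t ^ (-1 - (m : ℝ) / 2)) t
    + (Set.Ioc b 1).indicator
      (fun t : ℝ => (m : ℝ) / (2 + m) - 2 * (1 + (m : ℝ)) / (2 + m) * t ^ (-1 - (m : ℝ) / 2)) t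

/-- The class `F_m^spec`. -/
def specClass (m : ℕ) : Set (ℝ → ℝ) :=
  {f | ∃ b d : ℝ, 1 < b ∧ b < d ∧ 0 < coefD m b ∧
    -((2 + (m : ℝ)) / m) + coefD m b * b ^ ((m : ℝ) / 2) < 0 ∧
    0 < -((2 + (m : ℝ)) / m) + coefD m b * d ^ ((m : ℝ) / 2) ∧
    -((2 + (m : ℝ)) / m) + coefD m b * d ^ ((m : ℝ) / 2) < 2 ∧
    f = specFun m b d}

/-- The class `F_m^{*spec}`. -/
def specClassStar (m : ℕ) : Set (ℝ → ℝ) :=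
  {f | ∃ b d : ℝ, 0 < d ∧ d < b ∧ b < 1 ∧ 0 < coefDStar m b ∧
    -((m : ℝ) / (2 + m)) + coefDStar m b * b ^ (-1 - (m : ℝ) / 2) < 0 ∧
    0 < -((m : ℝ) / (2 + m)) + coefDStar m b * d ^ (-1 - (m : ℝ) / 2) ∧
    -((m : ℝ) / (2 + m)) + coefDStar m b * d ^ (-1 - (m : ℝ) / 2) < 2 ∧
    f = specFunStar m b d}

end

/-! Put `k = m/2` and let `s = (1+k)/k` be the conjugate exponent of `1+k`. The functions of both
classes solve `Tf = 1` and `Tf = -1` on their two pieces, and outside the support `|Tf| < 1`. The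
superlevel set is therefore the support, and each ratio is an explicit function of `b`, `d` and the
zero `z` of the piece containing `d`.

For `0 < x ≤ 1`, a ratio exceeds `1/x` iff a certain form in `b`, `z`, `d` is negative. In suitable
power variables both forms are controlled by the same three Young inequalities, whose distinguished
values are `a = (1+sx)^(1/s)`, `B = 1+x/s` and `α = (1+s)(2-a)/s`. In the first family they are
paired with `d/z`, `b` and the relation defining `z`; in the second the roles of `a` and `B` are
exchanged. If `gap s x = α^s - (1+s)(2-B^s)` is nonpositive, both forms are nonnegative
(`primal_form_nonneg`, `star_form_nonneg`). If it is positive, the forms are negative at the points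
`u = a`, `w = B` and `V = B`, `w = a` (`primal_form_neg`, `star_form_neg`).

These points must also lie in the classes. The bound `gap_nonpos` shows that a positive gap forces
`x > 1/2`, which yields the required order of `b` and `z`. Hence each constant exceeds `1/x` exactly
when `gap s x > 0`. Since `gap s 1 > 0`, both constants exceed 1, so these levels determine them. -/

/-! ### The reduced forms and Young's inequality -/

/-- Young's inequality in the form given by Bernoulli's inequality. -/
lemma young_rpow {s B P : ℝ} (hs : 1 ≤ s) (hB : 0 ≤ B) (hP : 0 < P) :
    s * B * P ^ (s - 1) ≤ B ^ s + (s - 1) * P ^ s := by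
  have h := one_add_mul_self_le_rpow_one_add (s := B / P - 1) (p := s)
    (by have := div_nonneg hB hP.le; linarith) hs
  rw [add_sub_cancel, Real.div_rpow hB hP.le, le_div_iff₀ (by positivity)] at h
  have h2 : P ^ s = P ^ (s - 1) * P := by
    rw [← Real.rpow_add_one hP.ne']; congr 1; ring
  have h3 : (1 + s * (B / P - 1)) * P ^ s = P ^ s - s * P ^ s + s * B * P ^ (s - 1) := by
    rw [h2]; field_simp; ring
  linarith

/-- Its sign at `x = 1 / R` decides whether the weak-type constants exceed `R`. -/
noncomputable def gap (s x : ℝ) : ℝ :=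
  ((1 + s) * (2 - (1 + s * x) ^ (1 / s)) / s) ^ s - (1 + s) * (2 - (1 + x / s) ^ s)

/-- Strict Bernoulli gives `1 + s x < (1+x)^s ≤ 2^s`. This bound keeps `D` positive at the extremal
point. -/
lemma root_lt_two {s x : ℝ} (hs : 1 < s) (hx : 0 < x) (hx1 : x ≤ 1) :
    (1 + s * x) ^ (1 / s) < 2 := by
  have hs0 : 0 < s := by linarith
  have h := one_add_mul_self_lt_rpow_one_add (s := x) (by linarith) hx.ne' hs
  have h2 : (1 + s * x) ^ (1 / s) < ((1 + x) ^ s) ^ (1 / s) :=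
    Real.rpow_lt_rpow (by positivity) h (by positivity)
  rw [one_div, Real.rpow_rpow_inv (by linarith) hs0.ne'] at h2
  rw [one_div]; linarith

lemma rpow_split {P : ℝ} (hP : 0 < P) (s : ℝ) : P ^ s = P ^ (s - 1) * P := by
  rw [← Real.rpow_add_one hP.ne']; congr 1; ring

/-- Here `u = b^k`, `Z = z^k`, `w = (d/z)^k`, and `hrel` says that `z` is the zero. Young is applied
to the pairs `(B, w)`, `(α, δ)` and `(a, u)` with `δ = (1+s)(2-u)/s`, so that `Z = u/δ`. All three
are equalities at `w = B`, `u = a`. -/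
lemma primal_form_nonneg {s x u Z w : ℝ} (hs : 1 < s) (hx : 0 < x) (hx1 : x ≤ 1) (hu : 0 < u)
    (hZ : 0 < Z) (hw : 0 < w) (hrel : (1 + s) * (2 - u) * Z = s * u) (hg : gap s x ≤ 0) :
    0 ≤ 1 + s * x - 2 * u ^ (s - 1)
      + s * Z ^ (s - 1) * (2 + (s - 1) * w ^ s - s * (1 + x / s) * w ^ (s - 1)) := by
  have hs0 : 0 < s := by linarith
  unfold gap at hg
  have ha2 := root_lt_two hs hx hx1
  have has : ((1 + s * x) ^ (1 / s)) ^ s = 1 + s * x := by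
    rw [one_div, Real.rpow_inv_rpow (by positivity) hs0.ne']
  have ha0 : 0 < (1 + s * x) ^ (1 / s) := by positivity
  generalize (1 + s * x) ^ (1 / s) = a at *
  have hB : 0 ≤ 1 + x / s := by positivity
  have h1 := young_rpow hs.le hB hw
  generalize 1 + x / s = B at *
  have hα : 0 ≤ (1 + s) * (2 - a) / s := div_nonneg (mul_nonneg (by linarith) (by linarith)) hs0.le
  have hu2 : 0 < 2 - u := by
    by_contra hcon
    have : (1 + s) * (2 - u) * Z ≤ 0 :=
      mul_nonpos_of_nonpos_of_nonneg (mul_nonpos_of_nonneg_of_nonpos (by linarith) (by linarith))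
        hZ.le
    have : 0 < s * u := by positivity
    linarith
  have hδ : 0 < (1 + s) * (2 - u) / s := by positivity
  have hZe : Z = u / ((1 + s) * (2 - u) / s) := by
    rw [eq_div_iff hδ.ne']; field_simp; linarith
  have h2 := young_rpow hs.le hα hδ
  rw [rpow_split hδ s] at h2
  have h3 := young_rpow hs.le ha0.le hu
  rw [has, rpow_split hu s] at h3
  have hZs : Z ^ (s - 1) = u ^ (s - 1) / ((1 + s) * (2 - u) / s) ^ (s - 1) := by
    rw [hZe, Real.div_rpow hu.le hδ.le]
  have hZ0 : 0 < Z ^ (s - 1) := by positivity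
  have hu0 : 0 < u ^ (s - 1) := by positivity
  have hd0 : 0 < ((1 + s) * (2 - u) / s) ^ (s - 1) := by positivity
  generalize Z ^ (s - 1) = ζ at *
  generalize u ^ (s - 1) = υ at *
  generalize ((1 + s) * (2 - u) / s) ^ (s - 1) = η at *
  have hζη : ζ * η = υ := by rw [hZs]; field_simp
  have h4 : s * ζ * (2 - B ^ s) ≤
      s * ζ * (2 + (s - 1) * w ^ s - s * B * w ^ (s - 1)) := by
    apply mul_le_mul_of_nonneg_left _ (by positivity); linarith
  -- Young for `(α, δ)` and the sign of the gap, scaled by `s ζ/(1+s)`, turn the second term into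
  -- one in `u` alone; the pair `(a, u)` then finishes.
  have h5 : υ * (s * (2 - a) - (s - 1) * (2 - u)) ≤ s * ζ * (2 - B ^ s) := by
    have h6 : s * ((1 + s) * (2 - a) / s) * η - (s - 1) * (η * ((1 + s) * (2 - u) / s))
        ≤ (1 + s) * (2 - B ^ s) := by linarith
    have h7 := mul_le_mul_of_nonneg_left h6 (show 0 ≤ s * ζ / (1 + s) by positivity)
    have e1 : s * ζ / (1 + s) * ((1 + s) * (2 - B ^ s)) = s * ζ * (2 - B ^ s) := by field_simp
    have e2 : s * ζ / (1 + s) * (s * ((1 + s) * (2 - a) / s) * η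
        - (s - 1) * (η * ((1 + s) * (2 - u) / s)))
        = (ζ * η) * (s * (2 - a) - (s - 1) * (2 - u)) := by field_simp
    rw [e1, e2, hζη] at h7
    exact h7
  nlinarith

/-- At `u = a` one has `δ = α`, and the form equals `-s Z^(s-1) gap/(1+s)`. -/
lemma primal_form_neg {s x a Z : ℝ} (hs : 1 < s) (hx : 0 < x)
    (ha : a = (1 + s * x) ^ (1 / s)) (ha2 : a < 2)
    (hZ : Z = s * a / ((1 + s) * (2 - a))) (hg : 0 < gap s x) :
    1 + s * x - 2 * a ^ (s - 1) + s * Z ^ (s - 1) *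
      (2 + (s - 1) * (1 + x / s) ^ s - s * (1 + x / s) * (1 + x / s) ^ (s - 1)) < 0 := by
  have hs0 : 0 < s := by linarith
  unfold gap at hg
  have ha0 : 0 < a := by rw [ha]; positivity
  have has : a ^ s = 1 + s * x := by
    rw [ha, one_div, Real.rpow_inv_rpow (by positivity) hs0.ne']
  rw [← ha] at hg
  have hB : 0 < 1 + x / s := by positivity
  generalize 1 + x / s = B at *
  have ha2' : 0 < 2 - a := by linarith
  have hα : 0 < (1 + s) * (2 - a) / s := by positivity
  have hZe : Z = a / ((1 + s) * (2 - a) / s) := by rw [hZ]; field_simp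
  have hZs : Z ^ (s - 1) = a ^ (s - 1) / ((1 + s) * (2 - a) / s) ^ (s - 1) := by
    rw [hZe, Real.div_rpow ha0.le hα.le]
  rw [rpow_split hα s] at hg
  rw [rpow_split ha0 s] at has
  have hυ : 0 < a ^ (s - 1) := by positivity
  have hη : 0 < ((1 + s) * (2 - a) / s) ^ (s - 1) := by positivity
  rw [hZs, ← has, rpow_split hB s]
  rw [rpow_split hB s] at hg
  generalize a ^ (s - 1) = υ at *
  generalize ((1 + s) * (2 - a) / s) ^ (s - 1) = η at *
  generalize B ^ (s - 1) = β at *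
  have h1 : s * (υ / η) / (1 + s) * ((1 + s) * (2 - β * B))
      < s * (υ / η) / (1 + s) * (η * ((1 + s) * (2 - a) / s)) :=
    mul_lt_mul_of_pos_left (by linarith) (by positivity)
  have e1 : s * (υ / η) / (1 + s) * ((1 + s) * (2 - β * B)) =
      s * (υ / η) * (2 + (s - 1) * (β * B) - s * B * β) := by field_simp; ring
  have e2 : s * (υ / η) / (1 + s) * (η * ((1 + s) * (2 - a) / s)) = υ * (2 - a) := by
    field_simp
  rw [e1, e2] at h1
  linarith

/-- Here `V = b^(-k)`, `Q = (z/b)^k`, `w = (z/d)^k`. The Young pairs are now `(B, V)`, `(α, Q)` and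
`(a, w)`. -/
lemma star_form_nonneg {s x V Q w : ℝ} (hs : 1 < s) (hx : 0 < x) (hx1 : x ≤ 1) (hV : 0 < V)
    (hQ : 0 < Q) (hw : 0 < w) (hrel : Q ^ s = (1 + s) * (2 - V ^ s)) (hg : gap s x ≤ 0) :
    0 ≤ 2 - (1 + x / s) * V ^ (s - 1)
      - Q ^ (s - 1) / s * (2 - ((s - 1) * w + (1 + s * x) / w ^ (s - 1)) / s) := by
  have hs0 : 0 < s := by linarith
  unfold gap at hg
  have ha2 := root_lt_two hs hx hx1
  have has : ((1 + s * x) ^ (1 / s)) ^ s = 1 + s * x := by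
    rw [one_div, Real.rpow_inv_rpow (by positivity) hs0.ne']
  have ha0 : 0 < (1 + s * x) ^ (1 / s) := by positivity
  generalize (1 + s * x) ^ (1 / s) = a at *
  have hB : 0 ≤ 1 + x / s := by positivity
  have h1 := young_rpow hs.le hB hV
  generalize 1 + x / s = B at *
  have hα : 0 ≤ (1 + s) * (2 - a) / s := div_nonneg (mul_nonneg (by linarith) (by linarith)) hs0.le
  have h2 := young_rpow hs.le hα hQ
  rw [hrel] at h2
  have h3 := young_rpow hs.le ha0.le hw
  rw [has, rpow_split hw s] at h3
  have hw0 : 0 < w ^ (s - 1) := by positivity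
  have hq0 : 0 < Q ^ (s - 1) := by positivity
  have h4 : s * a ≤ (s - 1) * w + (1 + s * x) / w ^ (s - 1) := by
    rw [← sub_le_iff_le_add', le_div_iff₀ hw0]; linarith
  have h4' : a ≤ ((s - 1) * w + (1 + s * x) / w ^ (s - 1)) / s := by
    rw [le_div_iff₀ hs0]; linarith
  have h5 : Q ^ (s - 1) / s * (2 - ((s - 1) * w + (1 + s * x) / w ^ (s - 1)) / s)
      ≤ Q ^ (s - 1) / s * (2 - a) :=
    mul_le_mul_of_nonneg_left (by linarith) (by positivity)
  have h6 : s * (Q ^ (s - 1) / s * (2 - a)) ≤ (2 - B ^ s) + (s - 1) * (2 - V ^ s) := by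
    have h7 : s * ((1 + s) * (2 - a) / s) * Q ^ (s - 1)
        ≤ (1 + s) * ((2 - B ^ s) + (s - 1) * (2 - V ^ s)) := by linarith
    have e : s * ((1 + s) * (2 - a) / s) * Q ^ (s - 1)
        = (1 + s) * (s * (Q ^ (s - 1) / s * (2 - a))) := by field_simp
    rw [e] at h7
    exact le_of_mul_le_mul_left h7 (by linarith)
  have h8 : s * (B * V ^ (s - 1) + Q ^ (s - 1) / s * (2 - a)) ≤ s * 2 := by linarith
  have h9 := le_of_mul_le_mul_left h8 hs0
  linarith

/-- At `V = B`, `w = a` the form equals `Q^(s-1) (Q - α)/(1+s)`, while the gap is `α^s - Q^s`. -/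
lemma star_form_neg {s x a Q : ℝ} (hs : 1 < s) (hx : 0 < x)
    (ha : a = (1 + s * x) ^ (1 / s)) (ha2 : a < 2) (hQ : 0 < Q)
    (hrel : Q ^ s = (1 + s) * (2 - (1 + x / s) ^ s)) (hg : 0 < gap s x) :
    2 - (1 + x / s) * (1 + x / s) ^ (s - 1)
      - Q ^ (s - 1) / s * (2 - ((s - 1) * a + (1 + s * x) / a ^ (s - 1)) / s) < 0 := by
  have hs0 : 0 < s := by linarith
  unfold gap at hg
  have ha0 : 0 < a := by rw [ha]; positivity
  have has : a ^ s = 1 + s * x := by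
    rw [ha, one_div, Real.rpow_inv_rpow (by positivity) hs0.ne']
  rw [← ha, ← hrel] at hg
  have hB : 0 < 1 + x / s := by positivity
  have ha2' : 0 < 2 - a := by linarith
  have hα : 0 < (1 + s) * (2 - a) / s := by positivity
  have h1 : Q < (1 + s) * (2 - a) / s := by
    rw [← Real.rpow_lt_rpow_iff hQ.le hα.le hs0]; linarith
  rw [← has, rpow_split ha0 s]
  rw [rpow_split hB s, rpow_split hQ s] at hrel
  have hυ : 0 < a ^ (s - 1) := by positivity
  have hη : 0 < Q ^ (s - 1) := by positivity
  generalize a ^ (s - 1) = υ at *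
  generalize Q ^ (s - 1) = η at *
  generalize (1 + x / s) ^ (s - 1) = β at *
  have e : ((s - 1) * a + υ * a / υ) / s = a := by field_simp; ring
  rw [e]
  have h2 : η * Q < η * ((1 + s) * (2 - a) / s) := mul_lt_mul_of_pos_left h1 hη
  rw [hrel] at h2
  have e2 : η * ((1 + s) * (2 - a) / s) = (1 + s) * (η / s * (2 - a)) := by field_simp
  rw [e2] at h2
  have := lt_of_mul_lt_mul_left h2 (by linarith)
  linarith

/-! ### The sign of the gap and its consequences -/

lemma gap_pos_of_two_le {s x : ℝ} (hs : 1 < s) (hx : 0 < x) (hx1 : x ≤ 1)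
    (h : 2 ≤ (1 + x / s) ^ s) : 0 < gap s x := by
  have ha := root_lt_two hs hx hx1
  unfold gap
  have h1 : 0 < ((1 + s) * (2 - (1 + s * x) ^ (1 / s)) / s) ^ s := by
    have : 0 < 2 - (1 + s * x) ^ (1 / s) := by linarith
    positivity
  nlinarith

lemma gap_one_pos {s : ℝ} (hs : 1 < s) : 0 < gap s 1 := by
  apply gap_pos_of_two_le hs one_pos le_rfl
  have h := one_add_mul_self_le_rpow_one_add (s := 1 / s) (p := s)
    (by have : 0 < 1 / s := by positivity
        linarith) hs.le
  rwa [mul_one_div_cancel (by linarith), one_add_one_eq_two] at h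

/-- Bernoulli for the exponent `s - 1` in `[0, 1]`, times one more factor. It settles the endpoint
estimates below for `s ≤ 2`; the remaining value `s = 3` is numerical. -/
lemma one_add_rpow_le_of_le_two {s y : ℝ} (hs : 1 ≤ s) (hs2 : s ≤ 2) (hy : 0 ≤ y) :
    (1 + y) ^ s ≤ (1 + (s - 1) * y) * (1 + y) := by
  rw [rpow_split (by linarith) s]
  exact mul_le_mul_of_nonneg_right
    (rpow_one_add_le_one_add_mul_self (by linarith) (by linarith) (by linarith)) (by linarith)

lemma one_add_half_inv_rpow_le {s : ℝ} (hs : 1 < s) (h : s ≤ 2 ∨ s = 3) :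
    (1 + 1 / 2 / s) ^ s ≤ (1 + 2 * s) / (1 + s) := by
  rcases h with h | rfl
  · refine (one_add_rpow_le_of_le_two hs.le h (by positivity)).trans ?_
    rw [le_div_iff₀ (by linarith)]
    have e : (1 + (s - 1) * (1 / 2 / s)) * (1 + 1 / 2 / s) * (1 + s)
        = (1 + 2 * s) - (1 + 2 * s) * (s - 1) ^ 2 / (4 * s ^ 2) := by field_simp; ring
    rw [e]
    have : 0 ≤ (1 + 2 * s) * (s - 1) ^ 2 / (4 * s ^ 2) := by positivity
    linarith
  · norm_num

lemma one_add_inv_succ_rpow_le {s : ℝ} (hs : 1 < s) (h : s ≤ 2 ∨ s = 3) :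
    (1 + 1 / (1 + s)) ^ s ≤ 1 + s / 2 := by
  rcases h with h | rfl
  · refine (one_add_rpow_le_of_le_two hs.le h (by positivity)).trans ?_
    have e : (1 + (s - 1) * (1 / (1 + s))) * (1 + 1 / (1 + s))
        = (1 + s / 2) - (s + 2) * (s - 1) ^ 2 / (2 * (1 + s) ^ 2) := by field_simp; ring
    rw [e]
    have : 0 ≤ (s + 2) * (s - 1) ^ 2 / (2 * (1 + s) ^ 2) := by positivity
    linarith
  · norm_num

lemma one_add_inv_rpow_le {s : ℝ} (hs : 1 < s) (h : s ≤ 2 ∨ s = 3) :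
    ((1 + s) / s) ^ s ≤ 1 + s := by
  have e0 : (1 + s) / s = 1 + 1 / s := by field_simp; ring
  rw [e0]
  rcases h with h | rfl
  · refine (one_add_rpow_le_of_le_two hs.le h (by positivity)).trans ?_
    have e : (1 + (s - 1) * (1 / s)) * (1 + 1 / s)
        = (1 + s) - (1 + s) * (s - 1) ^ 2 / s ^ 2 := by field_simp; ring
    rw [e]
    have : 0 ≤ (1 + s) * (s - 1) ^ 2 / s ^ 2 := by positivity
    linarith
  · norm_num

lemma one_add_inv_succ_le_root {s : ℝ} (hs : 1 < s) (h : s ≤ 2 ∨ s = 3) :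
    1 + 1 / (1 + s) ≤ (1 + s * (1 / 2)) ^ (1 / s) := by
  have hs0 : 0 < s := by linarith
  rw [one_div s, Real.le_rpow_inv_iff_of_pos (by positivity) (by positivity) hs0]
  have := one_add_inv_succ_rpow_le hs h
  linarith

/-- Below `x = 1/2` the gap is nonpositive: compare with the chords on `[0, 1/2]`. -/
lemma gap_nonpos {s x : ℝ} (hs : 1 < s) (h : s ≤ 2 ∨ s = 3) (hx : 0 < x) (hx2 : x ≤ 1 / 2) :
    gap s x ≤ 0 := by
  have hs0 : 0 < s := by linarith
  have hB : (1 + x / s) ^ s ≤ (1 - 2 * x) * 1 + 2 * x * ((1 + 2 * s) / (1 + s)) := by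
    have hc := (convexOn_rpow hs.le).2 (show (1 : ℝ) ∈ Set.Ici 0 by simp)
      (show 1 + 1 / 2 / s ∈ Set.Ici 0 from Set.mem_Ici.2 (by positivity))
      (show 0 ≤ 1 - 2 * x by linarith) (show 0 ≤ 2 * x by linarith) (by ring)
    simp only [smul_eq_mul, Real.one_rpow] at hc
    have e : (1 - 2 * x) * 1 + 2 * x * (1 + 1 / 2 / s) = 1 + x / s := by field_simp; ring
    rw [e] at hc
    have := mul_le_mul_of_nonneg_left (one_add_half_inv_rpow_le hs h)
      (show (0 : ℝ) ≤ 2 * x by linarith)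
    linarith
  have ha : 1 + 2 * x / (1 + s) ≤ (1 + s * x) ^ (1 / s) := by
    have hr : 1 / s ≤ 1 := by rw [div_le_one hs0]; exact hs.le
    have hc := (Real.concaveOn_rpow (p := 1 / s) (by positivity) hr).2
      (show (1 : ℝ) ∈ Set.Ici 0 by simp)
      (show 1 + s * (1 / 2) ∈ Set.Ici 0 from Set.mem_Ici.2 (by positivity))
      (show 0 ≤ 1 - 2 * x by linarith) (show 0 ≤ 2 * x by linarith) (by ring)
    simp only [smul_eq_mul, Real.one_rpow] at hc
    have e : (1 - 2 * x) * 1 + 2 * x * (1 + s * (1 / 2)) = 1 + s * x := by ring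
    rw [e] at hc
    have h2 := mul_le_mul_of_nonneg_left (one_add_inv_succ_le_root hs h)
      (show (0 : ℝ) ≤ 2 * x by linarith)
    have e2 : 2 * x * (1 + 1 / (1 + s)) = 2 * x + 2 * x / (1 + s) := by ring
    linarith
  have hα : ((1 + s) * (2 - (1 + s * x) ^ (1 / s)) / s) ^ s ≤ (1 - 2 * x) * (1 + s) + 2 * x := by
    have hlt := root_lt_two hs hx (by linarith)
    have hc := (convexOn_rpow hs.le).2
      (show (1 + s) / s ∈ Set.Ici 0 from Set.mem_Ici.2 (by positivity))
      (show (1 : ℝ) ∈ Set.Ici 0 by simp)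
      (show 0 ≤ 1 - 2 * x by linarith) (show 0 ≤ 2 * x by linarith) (by ring)
    simp only [smul_eq_mul, Real.one_rpow] at hc
    have h1 := mul_le_mul_of_nonneg_left (one_add_inv_rpow_le hs h)
      (show (0 : ℝ) ≤ 1 - 2 * x by linarith)
    have h2 : ((1 + s) * (2 - (1 + s * x) ^ (1 / s)) / s) ^ s ≤
        ((1 - 2 * x) * ((1 + s) / s) + 2 * x * 1) ^ s := by
      apply Real.rpow_le_rpow _ _ hs0.le
      · exact div_nonneg (mul_nonneg (by linarith) (by linarith)) hs0.le
      · have e : (1 - 2 * x) * ((1 + s) / s) + 2 * x * 1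
            = (1 + s) * (2 - (1 + 2 * x / (1 + s))) / s := by field_simp; ring
        rw [e]; gcongr
    linarith
  -- The chord bounds for the two terms of the gap agree exactly, so nothing is left over.
  have e3 : (1 + s) * (2 - ((1 - 2 * x) * 1 + 2 * x * ((1 + 2 * s) / (1 + s))))
      = (1 - 2 * x) * (1 + s) + 2 * x := by field_simp; ring
  have h4 := mul_le_mul_of_nonneg_left hB (show 0 ≤ 1 + s by linarith)
  unfold gap
  linarith

lemma half_lt_of_gap_pos {s x : ℝ} (hs : 1 < s) (h : s ≤ 2 ∨ s = 3) (hx : 0 < x)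
    (hg : 0 < gap s x) : 1 / 2 < x := by
  by_contra hc
  linarith [gap_nonpos hs h hx (by linarith)]

lemma root_gt {s x : ℝ} (hs : 1 < s) (h : s ≤ 2 ∨ s = 3) (hx : 1 / 2 < x) :
    1 + 1 / (1 + s) < (1 + s * x) ^ (1 / s) := by
  refine (one_add_inv_succ_le_root hs h).trans_lt ?_
  apply Real.rpow_lt_rpow (by positivity) _ (by positivity)
  nlinarith

/-- Since `x > 1/2`, `root_gt` gives `α ≤ 1`, and a positive gap then forces `(1+s)(2-B^s) < 1`.
This is what puts `z` below `b` in the second family. -/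
lemma lt_rpow_of_gap_pos {s x : ℝ} (hs : 1 < s) (h : s ≤ 2 ∨ s = 3) (hx : 0 < x)
    (hx1 : x ≤ 1) (hg : 0 < gap s x) : 2 - 1 / (1 + s) < (1 + x / s) ^ s := by
  have h1 := root_gt hs h (half_lt_of_gap_pos hs h hx hg)
  have h2 := root_lt_two hs hx hx1
  unfold gap at hg
  have h3 : ((1 + s) * (2 - (1 + s * x) ^ (1 / s)) / s) ^ s ≤ 1 := by
    apply Real.rpow_le_one
    · exact div_nonneg (mul_nonneg (by linarith) (by linarith)) (by linarith)
    · rw [div_le_one (by linarith)]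
      have e : (1 + s) * (2 - (1 + 1 / (1 + s))) = s := by field_simp; ring
      nlinarith
    · linarith
  have h4 : (1 + s) * (2 - (1 + x / s) ^ s) < 1 := by linarith
  rw [← lt_div_iff₀' (by linarith)] at h4
  linarith

/-- The extremal point of the second family needs `B^s < 2`, for otherwise `D_* ≤ 0`. If this fails
at `x`, the gap is still positive where `B^s = 2`, hence by continuity slightly to the left. -/
lemma exists_gap_pos_rpow_lt_two {s x : ℝ} (hs : 1 < s) (hx : 0 < x) (hx1 : x ≤ 1)
    (hg : 0 < gap s x) : ∃ y, 0 < y ∧ y ≤ x ∧ 0 < gap s y ∧ (1 + y / s) ^ s < 2 := by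
  have hs0 : 0 < s := by linarith
  rcases lt_or_ge ((1 + x / s) ^ s) 2 with h | h
  · exact ⟨x, hx, le_rfl, hg, h⟩
  set c : ℝ := s * (2 ^ (1 / s) - 1) with hc
  have hcs : (1 + c / s) ^ s = 2 := by
    have : 1 + c / s = 2 ^ s⁻¹ := by rw [hc]; field_simp; ring
    rw [this, Real.rpow_inv_rpow (by norm_num) hs0.ne']
  have hc0 : 0 < c := by
    have : (1 : ℝ) < 2 ^ (1 / s) := Real.one_lt_rpow (by norm_num) (by positivity)
    rw [hc]; exact mul_pos hs0 (by linarith)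
  have hcx : c ≤ x := by
    rw [← hcs, Real.rpow_le_rpow_iff (by positivity) (by positivity) hs0] at h
    have : c / s ≤ x / s := by linarith
    rwa [div_le_div_iff_of_pos_right hs0] at this
  have hgc := gap_pos_of_two_le hs hc0 (hcx.trans hx1) hcs.ge
  have hcont : ContinuousAt (gap s) c := by
    unfold gap
    refine ContinuousAt.sub (ContinuousAt.rpow_const ?_ (Or.inr hs0.le)) ?_
    · refine ContinuousAt.div_const (continuousAt_const.mul (continuousAt_const.sub ?_)) _
      exact ContinuousAt.rpow_const (by fun_prop) (Or.inr (by positivity))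
    · refine continuousAt_const.mul (continuousAt_const.sub ?_)
      exact ContinuousAt.rpow_const (by fun_prop) (Or.inr hs0.le)
  have hev : ∀ᶠ y in nhdsWithin c (Set.Iio c), 0 < gap s y ∧ 0 < y ∧ y < c :=
    ((hcont.eventually (lt_mem_nhds hgc)).filter_mono nhdsWithin_le_nhds).and
      (((lt_mem_nhds hc0).filter_mono nhdsWithin_le_nhds).and self_mem_nhdsWithin)
  obtain ⟨y, hy1, hy2, hy3⟩ := hev.exists
  refine ⟨y, hy2, by linarith, hy1, ?_⟩
  rw [← hcs]
  apply Real.rpow_lt_rpow (by positivity) _ hs0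
  gcongr

/-! ### Integrals of power functions and `L¹` norms -/

lemma integral_congr_uIoc {f g : ℝ → ℝ} {a b : ℝ} (h : Set.EqOn f g (Set.uIoc a b)) :
    ∫ t in a..b, f t = ∫ t in a..b, g t :=
  intervalIntegral.integral_congr_ae (Filter.Eventually.of_forall fun _ ht => h ht)

lemma integral_two_rpow {g : ℝ → ℝ} {a b c e p₁ p₂ : ℝ} (ha : 0 < a) (hab : a ≤ b)
    (hp₁ : p₁ ≠ -1) (hp₂ : p₂ ≠ -1)
    (h : ∀ t ∈ Set.Ioc a b, g t = c * t ^ p₁ + e * t ^ p₂) :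
    IntervalIntegrable g volume a b ∧ ∫ t in a..b, g t =
      c * ((b ^ (p₁ + 1) - a ^ (p₁ + 1)) / (p₁ + 1))
        + e * ((b ^ (p₂ + 1) - a ^ (p₂ + 1)) / (p₂ + 1)) := by
  have h0 : (0 : ℝ) ∉ Set.uIcc a b := Set.notMem_uIcc_of_lt ha (ha.trans_le hab)
  have i₁ : IntervalIntegrable (fun t : ℝ => c * t ^ p₁) volume a b :=
    (intervalIntegral.intervalIntegrable_rpow (Or.inr h0)).const_mul c
  have i₂ : IntervalIntegrable (fun t : ℝ => e * t ^ p₂) volume a b :=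
    (intervalIntegral.intervalIntegrable_rpow (Or.inr h0)).const_mul e
  have hcongr : Set.EqOn (fun t => c * t ^ p₁ + e * t ^ p₂) g (Set.uIoc a b) := by
    intro t ht
    rw [Set.uIoc_of_le hab] at ht
    exact (h t ht).symm
  refine ⟨(i₁.add i₂).congr hcongr, ?_⟩
  rw [← integral_congr_uIoc hcongr, intervalIntegral.integral_add i₁ i₂,
    intervalIntegral.integral_const_mul, intervalIntegral.integral_const_mul,
    integral_rpow (Or.inr ⟨hp₁, h0⟩), integral_rpow (Or.inr ⟨hp₂, h0⟩)]

lemma integral_const_add_rpow {a b c e p l : ℝ} (ha : 0 < a) (hab : a ≤ b) (hp : p ≠ -1) :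
    IntervalIntegrable (fun t => c + e * t ^ p) volume a b ∧
    (∫ t in a..b, (c + e * t ^ p)) =
      c * (b - a) + e * ((b ^ (p + 1) - a ^ (p + 1)) / (p + 1)) ∧
    ((∀ t ∈ Set.Ioc a b, l ≤ c + e * t ^ p) →
      l * (b - a) ≤ c * (b - a) + e * ((b ^ (p + 1) - a ^ (p + 1)) / (p + 1))) := by
  obtain ⟨h1, h2⟩ := integral_two_rpow (g := fun t => c + e * t ^ p) (c := c) (e := e) (p₁ := 0)
    (p₂ := p) ha hab (by norm_num) hp (fun t _ => by simp)
  have h3 : (∫ t in a..b, (c + e * t ^ p)) =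
      c * (b - a) + e * ((b ^ (p + 1) - a ^ (p + 1)) / (p + 1)) := by
    rw [h2]; simp
  refine ⟨h1, h3, fun hl => ?_⟩
  rw [← h3]
  have h4 : ∫ _ in a..b, l = l * (b - a) := by simp [mul_comm]
  rw [← h4, intervalIntegral.integral_of_le hab, intervalIntegral.integral_of_le hab]
  exact setIntegral_mono_on (by simp) ((intervalIntegrable_iff_integrableOn_Ioc_of_le hab).1 h1)
    measurableSet_Ioc hl

lemma lintegral_enorm_Ioc {f : ℝ → ℝ} {a b c e p : ℝ} (ha : 0 < a) (hab : a ≤ b) (hp : p ≠ -1)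
    (h : ∀ t ∈ Set.Ioc a b, |f t| = c + e * t ^ p) :
    ∫⁻ t in Set.Ioc a b, ‖f t‖ₑ =
      ENNReal.ofReal (c * (b - a) + e * ((b ^ (p + 1) - a ^ (p + 1)) / (p + 1))) ∧
    0 ≤ c * (b - a) + e * ((b ^ (p + 1) - a ^ (p + 1)) / (p + 1)) := by
  obtain ⟨h1, h2, h3⟩ := integral_const_add_rpow (c := c) (e := e) (l := 0) ha hab hp
  have hnn : ∀ t ∈ Set.Ioc a b, 0 ≤ c + e * t ^ p := fun t ht => (h t ht) ▸ abs_nonneg _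
  refine ⟨?_, by simpa using h3 hnn⟩
  rw [← h2, intervalIntegral.integral_of_le hab,
    ofReal_integral_eq_lintegral_ofReal ((intervalIntegrable_iff_integrableOn_Ioc_of_le hab).1 h1)
      ((ae_restrict_iff' measurableSet_Ioc).2 (Filter.Eventually.of_forall hnn))]
  refine setLIntegral_congr_fun measurableSet_Ioc fun t ht => ?_
  rw [Real.enorm_eq_ofReal_abs, h t ht]

lemma lintegral_enorm_Ici {f : ℝ → ℝ} {x₀ x₁ x₂ x₃ : ℝ} (h0 : 0 ≤ x₀) (h01 : x₀ ≤ x₁)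
    (h12 : x₁ ≤ x₂) (h23 : x₂ ≤ x₃) (hf : ∀ t ∉ Set.Ioc x₀ x₃, f t = 0) :
    ∫⁻ t in Set.Ici (0 : ℝ), ‖f t‖ₑ = (∫⁻ t in Set.Ioc x₀ x₁, ‖f t‖ₑ)
      + (∫⁻ t in Set.Ioc x₁ x₂, ‖f t‖ₑ) + ∫⁻ t in Set.Ioc x₂ x₃, ‖f t‖ₑ := by
  have h1 : ∫⁻ t in Set.Ici (0 : ℝ), ‖f t‖ₑ = ∫⁻ t in Set.Ioc x₀ x₃, ‖f t‖ₑ := by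
    rw [← lintegral_indicator measurableSet_Ici, ← lintegral_indicator measurableSet_Ioc]
    congr 1
    ext t
    by_cases ht : t ∈ Set.Ioc x₀ x₃
    · rw [Set.indicator_of_mem ht, Set.indicator_of_mem (Set.mem_Ici.2 (h0.trans ht.1.le))]
    · rw [Set.indicator_of_notMem ht]
      by_cases ht' : t ∈ Set.Ici (0 : ℝ)
      · rw [Set.indicator_of_mem ht', hf t ht, enorm_zero]
      · rw [Set.indicator_of_notMem ht']
  rw [h1, ← Set.Ioc_union_Ioc_eq_Ioc (h01.trans h12) h23,
    lintegral_union measurableSet_Ioc (Set.Ioc_disjoint_Ioc_of_le le_rfl),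
    ← Set.Ioc_union_Ioc_eq_Ioc h01 h12,
    lintegral_union measurableSet_Ioc (Set.Ioc_disjoint_Ioc_of_le le_rfl)]

/-! ### The first family: norm and superlevel set -/

lemma coefD_eq {m : ℕ} {k : ℝ} (hk : (m : ℝ) = 2 * k) (hk0 : 0 < k) {b : ℝ} (hb : 0 < b) :
    coefD m b = (1 + 2 * k) / k * (2 / b ^ k - 1) := by
  unfold coefD
  rw [hk, show -(2 * k) / 2 = -k by ring, Real.rpow_neg hb.le]
  field_simp

section primal

variable {m : ℕ} {k b d : ℝ}

lemma specFun_first (hk : (m : ℝ) = 2 * k) (hk0 : 0 < k) {t : ℝ} (ht : t ∈ Set.Ioc 1 b) :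
    specFun m b d t = (1 + k) / k - (1 + 2 * k) / k * t ^ k := by
  have h2 : t ∉ Set.Ioc b d := fun h => (lt_irrefl _ (ht.2.trans_lt h.1))
  unfold specFun
  rw [Set.indicator_of_mem ht, Set.indicator_of_notMem h2, hk,
    show 2 * k / 2 = k by ring]
  field_simp
  ring

lemma specFun_second (hk : (m : ℝ) = 2 * k) (hk0 : 0 < k) {t : ℝ} (ht : t ∈ Set.Ioc b d) :
    specFun m b d t = -((1 + k) / k) + coefD m b * t ^ k := by
  have h2 : t ∉ Set.Ioc 1 b := fun h => (lt_irrefl _ (h.2.trans_lt ht.1))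
  unfold specFun
  rw [Set.indicator_of_mem ht, Set.indicator_of_notMem h2, hk,
    show 2 * k / 2 = k by ring]
  field_simp
  ring

lemma specFun_zero (hb : 1 < b) (hd : b < d) {t : ℝ} (ht : t ∉ Set.Ioc 1 d) :
    specFun m b d t = 0 := by
  unfold specFun
  rw [Set.indicator_of_notMem, Set.indicator_of_notMem, add_zero]
  · exact fun h => ht ⟨hb.trans h.1, h.2⟩
  · exact fun h => ht ⟨h.1, h.2.trans hd.le⟩

/-- The sign of the function is constant on `(1,b]`, `(b,z]` and `(z,d]`. On the first it is at most
`-1`, whence `N > 0`. -/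
lemma specFun_norm (hk : (m : ℝ) = 2 * k) (hk0 : 0 < k) (hb : 1 < b) (hD : 0 < coefD m b)
    {z y : ℝ} (hbz : b ≤ z) (hzd : z < d) (hz : coefD m b * z ^ k = (1 + k) / k)
    (hd : coefD m b * d ^ k = (1 + k) / k + y) :
    ∃ N, 0 < N ∧ ∫⁻ t in Set.Ici (0 : ℝ), ‖specFun m b d t‖ₑ = ENNReal.ofReal N ∧
      (1 + k) / k * N = 1 - 2 * b + 2 * ((1 + k) / k) * z + d * (y / k - (1 + k) / k) := by
  have hb0 : 0 < b := by linarith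
  have hz0 : 0 < z := by linarith
  have hd0 : 0 < d := by linarith
  have hk1 : k ≠ -1 := by linarith
  have hneg : ∀ t ∈ Set.Ioc 1 b, 1 ≤ -((1 + k) / k) + (1 + 2 * k) / k * t ^ k := by
    intro t ht
    have h1 : 1 ≤ t ^ k := Real.one_le_rpow ht.1.le hk0.le
    have h2 : (1 + 2 * k) / k * 1 ≤ (1 + 2 * k) / k * t ^ k :=
      mul_le_mul_of_nonneg_left h1 (by positivity)
    have h3 : (1 + 2 * k) / k * 1 = 1 + (1 + k) / k := by field_simp; ring
    linarith
  obtain ⟨e1, -⟩ := lintegral_enorm_Ioc (f := specFun m b d) one_pos hb.le hk1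
    (c := -((1 + k) / k)) (e := (1 + 2 * k) / k) (fun t ht => by
      have := hneg t ht
      rw [specFun_first hk hk0 ht, abs_of_nonpos (by linarith)]; ring)
  have p1 := (integral_const_add_rpow one_pos hb.le hk1 (l := 1)).2.2 hneg
  obtain ⟨e2, p2⟩ := lintegral_enorm_Ioc (f := specFun m b d) hb0 hbz hk1
    (c := (1 + k) / k) (e := -coefD m b) (fun t ht => by
      have h1 : coefD m b * t ^ k ≤ coefD m b * z ^ k :=
        mul_le_mul_of_nonneg_left (Real.rpow_le_rpow (hb0.trans ht.1).le ht.2 hk0.le) hD.le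
      rw [specFun_second hk hk0 ⟨ht.1, ht.2.trans hzd.le⟩, abs_of_nonpos (by linarith)]; ring)
  obtain ⟨e3, p3⟩ := lintegral_enorm_Ioc (f := specFun m b d) hz0 hzd.le hk1
    (c := -((1 + k) / k)) (e := coefD m b) (fun t ht => by
      have h1 : coefD m b * z ^ k ≤ coefD m b * t ^ k :=
        mul_le_mul_of_nonneg_left (Real.rpow_le_rpow hz0.le ht.1.le hk0.le) hD.le
      rw [specFun_second hk hk0 ⟨hbz.trans_lt ht.1, ht.2⟩, abs_of_nonneg (by linarith)])
  refine ⟨-((1 + k) / k) * (b - 1) + (1 + 2 * k) / k * ((b ^ (k + 1) - 1 ^ (k + 1)) / (k + 1))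
    + ((1 + k) / k * (z - b) + -coefD m b * ((z ^ (k + 1) - b ^ (k + 1)) / (k + 1)))
    + (-((1 + k) / k) * (d - z) + coefD m b * ((d ^ (k + 1) - z ^ (k + 1)) / (k + 1))),
    by linarith, ?_, ?_⟩
  · rw [lintegral_enorm_Ici zero_le_one hb.le hbz hzd.le
      (fun t ht => specFun_zero hb (hbz.trans_lt hzd) ht), e1, e2, e3,
      ← ENNReal.ofReal_add (by linarith) p2, ← ENNReal.ofReal_add (by linarith) p3]
  · rw [Real.rpow_add_one hb0.ne', Real.rpow_add_one hz0.ne', Real.rpow_add_one hd0.ne',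
      Real.one_rpow]
    have hDb : coefD m b * b ^ k = (1 + 2 * k) / k * (2 - b ^ k) := by
      rw [coefD_eq hk hk0 hb0]
      have : 0 < b ^ k := by positivity
      field_simp
    have a1 : -coefD m b * ((z ^ k * z - b ^ k * b) / (k + 1)) =
        -(((1 + k) / k) * z - (1 + 2 * k) / k * (2 - b ^ k) * b) / (k + 1) := by
      rw [← hz, ← hDb]; ring
    have a2 : coefD m b * ((d ^ k * d - z ^ k * z) / (k + 1)) =
        (((1 + k) / k + y) * d - ((1 + k) / k) * z) / (k + 1) := by
      rw [← hd, ← hz]; ring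
    rw [a1, a2]
    field_simp
    ring

lemma specFun_primitive_first (hk : (m : ℝ) = 2 * k) (hk0 : 0 < k) (hb : 1 < b) (hd : b < d)
    {t : ℝ} (ht : 1 ≤ t) (htb : t ≤ b) :
    IntervalIntegrable (fun s => specFun m b d s * s ^ k) volume 0 t ∧
    ∫ s in (0 : ℝ)..t, specFun m b d s * s ^ k = (t ^ (1 + k) - t ^ (1 + k) * t ^ k) / k := by
  have hz : Set.EqOn (fun _ => (0 : ℝ)) (fun s => specFun m b d s * s ^ k) (Set.uIoc 0 1) := by
    intro s hs
    rw [Set.uIoc_of_le zero_le_one] at hs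
    simp only
    rw [specFun_zero hb hd (fun h => absurd h.1 (not_lt.2 hs.2)), zero_mul]
  have i0 : IntervalIntegrable (fun s => specFun m b d s * s ^ k) volume 0 1 :=
    (intervalIntegrable_const (c := (0 : ℝ))).congr hz
  obtain ⟨i1, h1⟩ := integral_two_rpow (g := fun s => specFun m b d s * s ^ k)
    (c := (1 + k) / k) (e := -((1 + 2 * k) / k)) (p₁ := k) (p₂ := k + k) one_pos ht
    (by linarith) (by linarith) (fun s hs => by
      rw [specFun_first hk hk0 ⟨hs.1, hs.2.trans htb⟩, Real.rpow_add (by linarith [hs.1])]; ring)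
  refine ⟨i0.trans i1, ?_⟩
  have ht0 : 0 < t := by linarith
  rw [← intervalIntegral.integral_add_adjacent_intervals i0 i1, h1,
    ← integral_congr_uIoc hz, intervalIntegral.integral_zero,
    show 1 + k = k + 1 by ring, show k + k + 1 = (k + 1) + k by ring, Real.rpow_add ht0 (k + 1) k,
    Real.one_rpow, Real.one_rpow]
  have : k + 1 + k ≠ 0 := by linarith
  field_simp
  ring

/-- The value of `D` is the one for which the integration constant at `b` cancels. -/
lemma specFun_primitive_second (hk : (m : ℝ) = 2 * k) (hk0 : 0 < k) (hb : 1 < b) (hd : b < d)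
    {t : ℝ} (ht : b ≤ t) (htd : t ≤ d) :
    IntervalIntegrable (fun s => specFun m b d s * s ^ k) volume 0 t ∧
    ∫ s in (0 : ℝ)..t, specFun m b d s * s ^ k =
      -(t ^ (1 + k) / k) + coefD m b / (1 + 2 * k) * (t ^ (1 + k) * t ^ k) := by
  obtain ⟨i0, h0⟩ := specFun_primitive_first hk hk0 hb hd hb.le le_rfl
  have hb0 : 0 < b := by linarith
  obtain ⟨i1, h1⟩ := integral_two_rpow (g := fun s => specFun m b d s * s ^ k)
    (c := -((1 + k) / k)) (e := coefD m b) (p₁ := k) (p₂ := k + k) hb0 ht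
    (by linarith) (by linarith) (fun s hs => by
      rw [specFun_second hk hk0 ⟨hs.1, hs.2.trans htd⟩, Real.rpow_add (by linarith [hs.1])]; ring)
  refine ⟨i0.trans i1, ?_⟩
  have ht0 : 0 < t := by linarith
  rw [← intervalIntegral.integral_add_adjacent_intervals i0 i1, h0, h1,
    show 1 + k = k + 1 by ring, show k + k + 1 = (k + 1) + k by ring, Real.rpow_add ht0 (k + 1) k,
    Real.rpow_add hb0 (k + 1) k, coefD_eq hk hk0 hb0]
  have : k + 1 + k ≠ 0 := by linarith
  have : 0 < b ^ k := by positivity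
  field_simp
  ring

lemma lam_eq (hk : (m : ℝ) = 2 * k) (f : ℝ → ℝ) (t : ℝ) :
    lam m f t = (1 + 2 * k) / t ^ (1 + k) * (∫ s in (0 : ℝ)..t, f s * s ^ k) - f t := by
  unfold lam
  rw [hk, show 2 * k / 2 = k by ring]

/-- The image is `1` on `(1,b]`, `-1` on `(b,d]` and `(d/t)^(1+k) (y-1)` beyond `d`, where `|y-1| <
1`. -/
lemma lam_specFun_superlevel (hk : (m : ℝ) = 2 * k) (hk0 : 0 < k) (hb : 1 < b) (hd : b < d)
    {y : ℝ} (hy : coefD m b * d ^ k = (1 + k) / k + y) (hy0 : 0 < y) (hy2 : y < 2) :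
    {t : ℝ | 0 ≤ t ∧ 1 ≤ |lam m (specFun m b d) t|} = Set.Ioc 1 d := by
  ext t
  rw [Set.mem_ofPred_eq]
  rcases le_or_gt t 1 with h1 | h1
  · refine iff_of_false ?_ (fun h => absurd h.1 (not_lt.2 h1))
    rintro ⟨h0, h⟩
    have hz : ∫ s in (0 : ℝ)..t, specFun m b d s * s ^ k = ∫ s in (0 : ℝ)..t, (0 : ℝ) := by
      refine integral_congr_uIoc fun s hs => ?_
      rw [Set.uIoc_of_le h0] at hs
      rw [specFun_zero hb hd (fun h => absurd h.1 (not_lt.2 (hs.2.trans h1))), zero_mul]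
    rw [lam_eq hk, hz, specFun_zero hb hd (fun h => absurd h.1 (not_lt.2 h1))] at h
    norm_num at h
  have ht0 : 0 < t := by linarith
  have hT : 0 < t ^ (1 + k) := by positivity
  rcases le_or_gt t b with h2 | h2
  · refine iff_of_true ⟨ht0.le, ?_⟩ ⟨h1, h2.trans hd.le⟩
    rw [lam_eq hk, (specFun_primitive_first hk hk0 hb hd h1.le h2).2, specFun_first hk hk0 ⟨h1, h2⟩]
    have : (1 + 2 * k) / t ^ (1 + k) * ((t ^ (1 + k) - t ^ (1 + k) * t ^ k) / k) -
      ((1 + k) / k - (1 + 2 * k) / k * t ^ k) = 1 := by field_simp; ring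
    rw [this]; simp
  rcases le_or_gt t d with h3 | h3
  · refine iff_of_true ⟨ht0.le, ?_⟩ ⟨h1, h3⟩
    rw [lam_eq hk, (specFun_primitive_second hk hk0 hb hd h2.le h3).2,
      specFun_second hk hk0 ⟨h2, h3⟩]
    have : (1 + 2 * k) / t ^ (1 + k) * (-(t ^ (1 + k) / k)
      + coefD m b / (1 + 2 * k) * (t ^ (1 + k) * t ^ k)) -
      (-((1 + k) / k) + coefD m b * t ^ k) = -1 := by field_simp; ring
    rw [this]; simp
  · refine iff_of_false ?_ (fun h => absurd h.2 (not_le.2 h3))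
    rintro ⟨-, h⟩
    obtain ⟨i0, e0⟩ := specFun_primitive_second hk hk0 hb hd hd.le le_rfl
    have hz : Set.EqOn (fun _ => (0 : ℝ)) (fun s => specFun m b d s * s ^ k) (Set.uIoc d t) := by
      intro s hs
      rw [Set.uIoc_of_le h3.le] at hs
      simp only
      rw [specFun_zero hb hd (fun h => absurd h.2 (not_le.2 hs.1)), zero_mul]
    have i1 : IntervalIntegrable (fun s => specFun m b d s * s ^ k) volume d t :=
      (intervalIntegrable_const (c := (0 : ℝ))).congr hz
    rw [lam_eq hk, specFun_zero hb hd (fun h => absurd h.2 (not_le.2 h3)), sub_zero,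
      ← intervalIntegral.integral_add_adjacent_intervals i0 i1,
      ← integral_congr_uIoc hz, intervalIntegral.integral_zero, add_zero, e0] at h
    have hd0 : 0 < d := by linarith
    have hle : d ^ (1 + k) ≤ t ^ (1 + k) := Real.rpow_le_rpow hd0.le h3.le (by linarith)
    have hdp : 0 < d ^ (1 + k) := by positivity
    have e : (1 + 2 * k) / t ^ (1 + k) * (-(d ^ (1 + k) / k)
        + coefD m b / (1 + 2 * k) * (d ^ (1 + k) * d ^ k)) =
        (d ^ (1 + k) / t ^ (1 + k)) * (y - 1) := by
      have : coefD m b / (1 + 2 * k) * (d ^ (1 + k) * d ^ k)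
          = d ^ (1 + k) * ((1 + k) / k + y) / (1 + 2 * k) := by rw [← hy]; ring
      rw [this]
      field_simp
      ring
    rw [e, abs_mul, abs_of_pos (by positivity)] at h
    have h4 : d ^ (1 + k) / t ^ (1 + k) ≤ 1 := (div_le_one hT).2 hle
    have h5 : |y - 1| < 1 := abs_lt.2 ⟨by linarith, by linarith⟩
    have h6 : d ^ (1 + k) / t ^ (1 + k) * |y - 1| ≤ 1 * |y - 1| :=
      mul_le_mul_of_nonneg_right h4 (abs_nonneg _)
    linarith

end primal

/-! ### The second family: norm and superlevel set -/

lemma coefDStar_eq {m : ℕ} {k : ℝ} (hk : (m : ℝ) = 2 * k) (hk0 : 0 < k) {b : ℝ} (hb : 0 < b) :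
    coefDStar m b = (1 + 2 * k) / (1 + k) * (2 / b ^ (-1 - k) - 1) := by
  unfold coefDStar
  rw [hk, show 1 + 2 * k / 2 = -(-1 - k) by ring, Real.rpow_neg hb.le]
  field_simp

section star

variable {m : ℕ} {k b d : ℝ}

lemma specFunStar_first (hk : (m : ℝ) = 2 * k) (hk0 : 0 < k) {t : ℝ} (ht : t ∈ Set.Ioc d b) :
    specFunStar m b d t = -(k / (1 + k)) + coefDStar m b * t ^ (-1 - k) := by
  have h2 : t ∉ Set.Ioc b 1 := fun h => (lt_irrefl _ (ht.2.trans_lt h.1))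
  unfold specFunStar
  rw [Set.indicator_of_mem ht, Set.indicator_of_notMem h2, hk,
    show 2 * k / 2 = k by ring]
  field_simp
  ring

lemma specFunStar_second (hk : (m : ℝ) = 2 * k) (hk0 : 0 < k) {t : ℝ} (ht : t ∈ Set.Ioc b 1) :
    specFunStar m b d t = k / (1 + k) - (1 + 2 * k) / (1 + k) * t ^ (-1 - k) := by
  have h2 : t ∉ Set.Ioc d b := fun h => (lt_irrefl _ (h.2.trans_lt ht.1))
  unfold specFunStar
  rw [Set.indicator_of_mem ht, Set.indicator_of_notMem h2, hk,
    show 2 * k / 2 = k by ring]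
  field_simp
  ring

lemma specFunStar_zero (hd : d < b) (hb : b < 1) {t : ℝ} (ht : t ∉ Set.Ioc d 1) :
    specFunStar m b d t = 0 := by
  unfold specFunStar
  rw [Set.indicator_of_notMem, Set.indicator_of_notMem, add_zero]
  · exact fun h => ht ⟨hd.trans h.1, h.2⟩
  · exact fun h => ht ⟨h.1, h.2.trans hb.le⟩

lemma specFunStar_norm (hk : (m : ℝ) = 2 * k) (hk0 : 0 < k) (hd0 : 0 < d) (hb : b < 1)
    (hD : 0 < coefDStar m b) {z y : ℝ} (hdz : d < z) (hzb : z ≤ b)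
    (hz : coefDStar m b * z ^ (-1 - k) = k / (1 + k))
    (hd : coefDStar m b * d ^ (-1 - k) = k / (1 + k) + y) :
    ∃ N, 0 < N ∧ ∫⁻ t in Set.Ici (0 : ℝ), ‖specFunStar m b d t‖ₑ = ENNReal.ofReal N ∧
      N = -((1 + k) / k) + 2 * ((1 + k) / k) * b - 2 * z + d * (1 + y / k) := by
  have hz0 : 0 < z := by linarith
  have hb0 : 0 < b := by linarith
  have hk1 : -1 - k ≠ -1 := by linarith
  have hk2 : -1 - k ≤ 0 := by linarith
  have hneg : ∀ t ∈ Set.Ioc b 1, 1 ≤ -(k / (1 + k)) + (1 + 2 * k) / (1 + k) * t ^ (-1 - k) := by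
    intro t ht
    have h1 : 1 ≤ t ^ (-1 - k) :=
      Real.one_le_rpow_of_pos_of_le_one_of_nonpos (hb0.trans ht.1) ht.2 hk2
    have h2 : (1 + 2 * k) / (1 + k) * 1 ≤ (1 + 2 * k) / (1 + k) * t ^ (-1 - k) :=
      mul_le_mul_of_nonneg_left h1 (by positivity)
    have h3 : (1 + 2 * k) / (1 + k) * 1 = 1 + k / (1 + k) := by field_simp; ring
    linarith
  obtain ⟨e1, -⟩ := lintegral_enorm_Ioc (f := specFunStar m b d) hb0 hb.le hk1
    (c := -(k / (1 + k))) (e := (1 + 2 * k) / (1 + k)) (fun t ht => by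
      have := hneg t ht
      rw [specFunStar_second hk hk0 ht, abs_of_nonpos (by linarith)]; ring)
  have p1 := (integral_const_add_rpow hb0 hb.le hk1 (l := 1)).2.2 hneg
  obtain ⟨e2, p2⟩ := lintegral_enorm_Ioc (f := specFunStar m b d) hz0 hzb hk1
    (c := k / (1 + k)) (e := -coefDStar m b) (fun t ht => by
      have h1 : coefDStar m b * t ^ (-1 - k) ≤ coefDStar m b * z ^ (-1 - k) :=
        mul_le_mul_of_nonneg_left (Real.rpow_le_rpow_of_nonpos hz0 ht.1.le hk2) hD.le
      rw [specFunStar_first hk hk0 ⟨hdz.trans ht.1, ht.2⟩, abs_of_nonpos (by linarith)]; ring)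
  obtain ⟨e3, p3⟩ := lintegral_enorm_Ioc (f := specFunStar m b d) hd0 hdz.le hk1
    (c := -(k / (1 + k))) (e := coefDStar m b) (fun t ht => by
      have h1 : coefDStar m b * z ^ (-1 - k) ≤ coefDStar m b * t ^ (-1 - k) :=
        mul_le_mul_of_nonneg_left (Real.rpow_le_rpow_of_nonpos (hd0.trans ht.1) ht.2 hk2) hD.le
      rw [specFunStar_first hk hk0 ⟨ht.1, ht.2.trans hzb⟩, abs_of_nonneg (by linarith)])
  refine ⟨(-(k / (1 + k)) * (z - d)
      + coefDStar m b * ((z ^ (-1 - k + 1) - d ^ (-1 - k + 1)) / (-1 - k + 1)))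
    + (k / (1 + k) * (b - z)
      + -coefDStar m b * ((b ^ (-1 - k + 1) - z ^ (-1 - k + 1)) / (-1 - k + 1)))
    + (-(k / (1 + k)) * (1 - b)
      + (1 + 2 * k) / (1 + k) * ((1 ^ (-1 - k + 1) - b ^ (-1 - k + 1)) / (-1 - k + 1))),
    by linarith, ?_, ?_⟩
  · rw [lintegral_enorm_Ici hd0.le hdz.le hzb hb.le
      (fun t ht => specFunStar_zero (hdz.trans_le hzb) hb ht), e1, e2, e3,
      ← ENNReal.ofReal_add p3 p2, ← ENNReal.ofReal_add (by linarith) (by linarith)]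
  · rw [Real.rpow_add_one hb0.ne', Real.rpow_add_one hz0.ne', Real.rpow_add_one hd0.ne',
      Real.one_rpow]
    have hDb : coefDStar m b * b ^ (-1 - k) = (1 + 2 * k) / (1 + k) * (2 - b ^ (-1 - k)) := by
      rw [coefDStar_eq hk hk0 hb0]
      have : 0 < b ^ (-1 - k) := by positivity
      field_simp
    rw [show -1 - k + 1 = -k by ring]
    have a1 : -coefDStar m b * ((b ^ (-1 - k) * b - z ^ (-1 - k) * z) / -k) =
        ((1 + 2 * k) / (1 + k) * (2 - b ^ (-1 - k)) * b - k / (1 + k) * z) / k := by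
      rw [← hz, ← hDb]; field_simp
    have a2 : coefDStar m b * ((z ^ (-1 - k) * z - d ^ (-1 - k) * d) / -k) =
        ((k / (1 + k) + y) * d - k / (1 + k) * z) / k := by
      rw [← hd, ← hz]; field_simp; ring
    rw [a1, a2]
    field_simp
    ring

lemma specFunStar_primitive_second (hk : (m : ℝ) = 2 * k) (hk0 : 0 < k) (hb0 : 0 < b)
    {t : ℝ} (ht : b ≤ t) (ht1 : t ≤ 1) :
    IntervalIntegrable (fun s => specFunStar m b d s * s ^ (-1 - k)) volume t 1 ∧
    ∫ s in t..1, specFunStar m b d s * s ^ (-1 - k) =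
      (t ^ (-k) - t ^ (-k) * t ^ (-1 - k)) / (1 + k) := by
  have ht0 : 0 < t := by linarith
  obtain ⟨i1, h1⟩ := integral_two_rpow (g := fun s => specFunStar m b d s * s ^ (-1 - k))
    (c := k / (1 + k)) (e := -((1 + 2 * k) / (1 + k))) (p₁ := -1 - k) (p₂ := -1 - k + (-1 - k))
    ht0 ht1 (by linarith) (by linarith) (fun s hs => by
      rw [specFunStar_second hk hk0 ⟨ht.trans_lt hs.1, hs.2⟩, Real.rpow_add (ht0.trans hs.1)]
      ring)
  refine ⟨i1, ?_⟩
  rw [h1, show -1 - k + (-1 - k) + 1 = -k + (-1 - k) by ring, show -1 - k + 1 = -k by ring,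
    Real.rpow_add ht0 (-k) (-1 - k), Real.one_rpow, Real.one_rpow,
    show -k + (-1 - k) = -(1 + 2 * k) by ring]
  field_simp
  ring

lemma specFunStar_primitive_first (hk : (m : ℝ) = 2 * k) (hk0 : 0 < k) (hd0 : 0 < d)
    (hb : b < 1) {t : ℝ} (ht : d ≤ t) (htb : t ≤ b) :
    IntervalIntegrable (fun s => specFunStar m b d s * s ^ (-1 - k)) volume t 1 ∧
    ∫ s in t..1, specFunStar m b d s * s ^ (-1 - k) =
      -(t ^ (-k) / (1 + k)) + coefDStar m b / (1 + 2 * k) * (t ^ (-k) * t ^ (-1 - k)) := by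
  have ht0 : 0 < t := by linarith
  have hb0 : 0 < b := by linarith
  obtain ⟨i0, h0⟩ := specFunStar_primitive_second (d := d) hk hk0 hb0 le_rfl hb.le
  obtain ⟨i1, h1⟩ := integral_two_rpow (g := fun s => specFunStar m b d s * s ^ (-1 - k))
    (c := -(k / (1 + k))) (e := coefDStar m b) (p₁ := -1 - k) (p₂ := -1 - k + (-1 - k))
    ht0 htb (by linarith) (by linarith) (fun s hs => by
      rw [specFunStar_first hk hk0 ⟨ht.trans_lt hs.1, hs.2⟩, Real.rpow_add (ht0.trans hs.1)]
      ring)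
  refine ⟨i1.trans i0, ?_⟩
  rw [← intervalIntegral.integral_add_adjacent_intervals i1 i0, h0, h1,
    show -1 - k + (-1 - k) + 1 = -k + (-1 - k) by ring, show -1 - k + 1 = -k by ring,
    Real.rpow_add ht0 (-k) (-1 - k), Real.rpow_add hb0 (-k) (-1 - k), coefDStar_eq hk hk0 hb0,
    show -k + (-1 - k) = -(1 + 2 * k) by ring]
  have : 0 < b ^ (-1 - k) := by positivity
  field_simp
  ring

lemma lamStar_eq (hk : (m : ℝ) = 2 * k) {f : ℝ → ℝ} (hf : ∀ s, 1 < s → f s = 0) {t : ℝ}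
    (ht0 : 0 ≤ t) (ht1 : t ≤ 1) :
    lamStar m f t = (1 + 2 * k) * t ^ k * (∫ s in t..1, f s * s ^ (-1 - k)) - f t := by
  unfold lamStar
  rw [hk, show 2 * k / 2 = k by ring, intervalIntegral.integral_of_le ht1,
    setIntegral_eq_of_subset_of_forall_sdiff_eq_zero measurableSet_Ioi
      (fun s hs => hs.1 : Set.Ioc t 1 ⊆ Set.Ioi t)
      (fun s hs => by
        rw [hf s (not_le.1 fun h => hs.2 ⟨hs.1, h⟩), zero_div])]
  congr 2
  refine setIntegral_congr_fun measurableSet_Ioc fun s hs => ?_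
  rw [show -1 - k = -(1 + k) by ring, Real.rpow_neg (ht0.trans hs.1.le), div_eq_mul_inv]

/-- The image is `1` on `(b,1]`, `-1` on `(d,b]` and `(t/d)^k (y-1)` on `(0,d]`. -/
lemma lamStar_specFunStar_superlevel (hk : (m : ℝ) = 2 * k) (hk0 : 0 < k) (hd0 : 0 < d)
    (hd : d < b) (hb : b < 1) {y : ℝ}
    (hy : coefDStar m b * d ^ (-1 - k) = k / (1 + k) + y) (hy0 : 0 < y) (hy2 : y < 2) :
    {t : ℝ | 0 ≤ t ∧ 1 ≤ |lamStar m (specFunStar m b d) t|} = Set.Ioc d 1 := by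
  have hf : ∀ s, 1 < s → specFunStar m b d s = 0 := fun s hs =>
    specFunStar_zero hd hb (fun h => absurd h.2 (not_le.2 hs))
  ext t
  rw [Set.mem_ofPred_eq]
  rcases lt_or_ge 1 t with h1 | h1
  · refine iff_of_false ?_ (fun h => absurd h.2 (not_le.2 h1))
    rintro ⟨h0, h⟩
    have hz : ∫ s in Set.Ioi t, specFunStar m b d s / s ^ (1 + (m : ℝ) / 2) = 0 := by
      refine setIntegral_eq_zero_of_forall_eq_zero fun s hs => ?_
      rw [hf s (h1.trans hs), zero_div]
    unfold lamStar at h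
    rw [hz, hf t h1] at h
    norm_num at h
  rcases le_or_gt t 0 with h0 | ht0
  · refine iff_of_false ?_ (fun h => absurd (hd0.trans h.1) (not_lt.2 h0))
    rintro ⟨h0', h⟩
    obtain rfl : t = 0 := le_antisymm h0 h0'
    rw [lamStar_eq hk hf le_rfl h1, Real.zero_rpow hk0.ne',
      specFunStar_zero hd hb (fun h => absurd (hd0.trans h.1) (lt_irrefl 0))] at h
    norm_num at h
  have hT : 0 < t ^ k := by positivity
  rw [lamStar_eq hk hf ht0.le h1]
  rcases lt_or_ge b t with h2 | h2
  · refine iff_of_true ⟨ht0.le, ?_⟩ ⟨hd.trans h2, h1⟩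
    rw [(specFunStar_primitive_second hk hk0 (hd0.trans hd) h2.le h1).2,
      specFunStar_second hk hk0 ⟨h2, h1⟩, Real.rpow_neg ht0.le]
    have : (1 + 2 * k) * t ^ k * (((t ^ k)⁻¹ - (t ^ k)⁻¹ * t ^ (-1 - k)) / (1 + k)) -
      (k / (1 + k) - (1 + 2 * k) / (1 + k) * t ^ (-1 - k)) = 1 := by field_simp; ring
    rw [this]; simp
  rcases lt_or_ge d t with h3 | h3
  · refine iff_of_true ⟨ht0.le, ?_⟩ ⟨h3, h1⟩
    rw [(specFunStar_primitive_first hk hk0 hd0 hb h3.le h2).2,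
      specFunStar_first hk hk0 ⟨h3, h2⟩, Real.rpow_neg ht0.le]
    have : (1 + 2 * k) * t ^ k * (-((t ^ k)⁻¹ / (1 + k))
      + coefDStar m b / (1 + 2 * k) * ((t ^ k)⁻¹ * t ^ (-1 - k))) -
      (-(k / (1 + k)) + coefDStar m b * t ^ (-1 - k)) = -1 := by field_simp; ring
    rw [this]; simp
  · refine iff_of_false ?_ (fun h => absurd h.1 (not_lt.2 h3))
    rintro ⟨-, h⟩
    obtain ⟨i0, e0⟩ := specFunStar_primitive_first hk hk0 hd0 hb le_rfl hd.le
    have hz : Set.EqOn (fun _ => (0 : ℝ)) (fun s => specFunStar m b d s * s ^ (-1 - k))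
        (Set.uIoc t d) := by
      intro s hs
      rw [Set.uIoc_of_le h3] at hs
      simp only
      rw [specFunStar_zero hd hb (fun h => absurd h.1 (not_lt.2 hs.2)), zero_mul]
    have i1 : IntervalIntegrable (fun s => specFunStar m b d s * s ^ (-1 - k)) volume t d :=
      (intervalIntegrable_const (c := (0 : ℝ))).congr hz
    rw [specFunStar_zero hd hb (fun h => absurd h.1 (not_lt.2 h3)), sub_zero,
      ← intervalIntegral.integral_add_adjacent_intervals i1 i0,
      ← integral_congr_uIoc hz, intervalIntegral.integral_zero, zero_add, e0,
      Real.rpow_neg hd0.le] at h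
    have hle : t ^ k ≤ d ^ k := Real.rpow_le_rpow ht0.le h3 hk0.le
    have hdp : 0 < d ^ k := by positivity
    have e : (1 + 2 * k) * t ^ k * (-((d ^ k)⁻¹ / (1 + k))
        + coefDStar m b / (1 + 2 * k) * ((d ^ k)⁻¹ * d ^ (-1 - k))) =
        (t ^ k / d ^ k) * (y - 1) := by
      have : coefDStar m b / (1 + 2 * k) * ((d ^ k)⁻¹ * d ^ (-1 - k))
          = (d ^ k)⁻¹ * (k / (1 + k) + y) / (1 + 2 * k) := by rw [← hy]; ring
      rw [this]
      field_simp
      ring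
    rw [e, abs_mul, abs_of_pos (by positivity)] at h
    have h4 : t ^ k / d ^ k ≤ 1 := (div_le_one hdp).2 hle
    have h5 : |y - 1| < 1 := abs_lt.2 ⟨by linarith, by linarith⟩
    have h6 : t ^ k / d ^ k * |y - 1| ≤ 1 * |y - 1| :=
      mul_le_mul_of_nonneg_right h4 (abs_nonneg _)
    linarith

end star

/-! ### Levels exceeded by the first constant -/

lemma ofReal_one_div_lt_div_iff {v N x : ℝ} (hv : 0 < v) (hN : 0 < N) (hx : 0 < x) :
    ENNReal.ofReal (1 / x) < ENNReal.ofReal v / ENNReal.ofReal N ↔ N < x * v := by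
  rw [← ENNReal.ofReal_div_of_pos hN, ENNReal.ofReal_lt_ofReal_iff (by positivity),
    div_lt_div_iff₀ hx hN, one_mul, mul_comm v]

lemma exponent_sub_one {k : ℝ} (hk0 : 0 < k) : (1 + k) / k - 1 = k⁻¹ := by
  field_simp; ring

section primal

variable {m : ℕ} {k b d z y x : ℝ}

/-- The form is `s (N - x (d-1))`; since `k (s-1) = 1`, the powers `s - 1` give back `b`, `z` and
`d/z`. -/
lemma specFun_ratio (hk : (m : ℝ) = 2 * k) (hk0 : 0 < k) (hb : 1 < b) (hD : 0 < coefD m b)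
    (hbz : b ≤ z) (hzd : z < d) (hz : coefD m b * z ^ k = (1 + k) / k)
    (hd : coefD m b * d ^ k = (1 + k) / k + y) (hy0 : 0 < y) (hy2 : y < 2) (hx : 0 < x) :
    (∫⁻ t in Set.Ici (0 : ℝ), ‖specFun m b d t‖ₑ) ≠ 0 ∧
    (ENNReal.ofReal (1 / x) < volume {t : ℝ | 0 ≤ t ∧ 1 ≤ |lam m (specFun m b d) t|} /
      (∫⁻ t in Set.Ici (0 : ℝ), ‖specFun m b d t‖ₑ) ↔
      1 + (1 + k) / k * x - 2 * (b ^ k) ^ ((1 + k) / k - 1)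
      + (1 + k) / k * (z ^ k) ^ ((1 + k) / k - 1) *
        (2 + ((1 + k) / k - 1) * ((d / z) ^ k) ^ ((1 + k) / k)
          - (1 + k) / k * (1 + x / ((1 + k) / k)) * ((d / z) ^ k) ^ ((1 + k) / k - 1)) < 0) := by
  obtain ⟨N, hN0, hN, hNe⟩ := specFun_norm hk hk0 hb hD hbz hzd hz hd
  have hz0 : 0 < z := by linarith
  have hd0 : 0 < d := by linarith
  have hs : 0 < (1 + k) / k := by positivity
  have hdz : 0 < d / z := by positivity
  refine ⟨by rw [hN]; simpa using hN0, ?_⟩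
  rw [hN, lam_specFun_superlevel hk hk0 hb (hbz.trans_lt hzd) hd hy0 hy2, Real.volume_Ioc,
    ofReal_one_div_lt_div_iff (by linarith) hN0 hx, rpow_split (by positivity) ((1 + k) / k),
    exponent_sub_one hk0, Real.rpow_rpow_inv (by linarith) hk0.ne',
    Real.rpow_rpow_inv hz0.le hk0.ne', Real.rpow_rpow_inv hdz.le hk0.ne']
  have hw : (1 + k) / k * (d / z) ^ k = (1 + k) / k + y := by
    rw [Real.div_rpow hd0.le hz0.le, ← hd, ← hz]
    have : 0 < z ^ k := by positivity
    field_simp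
  have hw' : (d / z) ^ k = 1 + k * y / (1 + k) := by
    rw [← mul_right_inj' hs.ne', hw]; field_simp
  have key : 1 + (1 + k) / k * x - 2 * b + (1 + k) / k * z *
        (2 + k⁻¹ * (d / z * (d / z) ^ k)
          - (1 + k) / k * (1 + x / ((1 + k) / k)) * (d / z))
      = (1 + k) / k * (N - x * (d - 1)) := by
    rw [mul_sub ((1 + k) / k) N, hNe, hw']
    field_simp
    ring
  rw [key, ← smul_eq_mul ((1 + k) / k) (N - _), smul_neg_iff_of_pos_left hs, sub_neg]

lemma gap_pos_of_lt_weakConst (hk : (m : ℝ) = 2 * k) (hk0 : 0 < k) (hx : 0 < x) (hx1 : x ≤ 1)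
    (h : ENNReal.ofReal (1 / x) < weakConstRestricted (lam m) (specClass m)) :
    0 < gap ((1 + k) / k) x := by
  unfold weakConstRestricted at h
  simp only [lt_iSup_iff] at h
  obtain ⟨f, ⟨⟨b, d, hb, hbd, hD, h1, h2, h3, rfl⟩, -⟩, h⟩ := h
  rw [hk, show (2 + 2 * k) / (2 * k) = (1 + k) / k by field_simp,
    show 2 * k / 2 = k by ring] at h1 h2 h3
  have hb0 : 0 < b := by linarith
  -- The zero of the second piece; the class inequalities place it in `(b, d)`.
  set z : ℝ := ((1 + k) / k / coefD m b) ^ k⁻¹ with hz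
  have hz0 : 0 < z := by positivity
  have hzk : coefD m b * z ^ k = (1 + k) / k := by
    rw [hz, Real.rpow_inv_rpow (by positivity) hk0.ne']; field_simp
  have hbz : b < z := by
    rw [← Real.rpow_lt_rpow_iff hb0.le hz0.le hk0, ← mul_lt_mul_iff_right₀ hD]; linarith
  have hzd : z < d := by
    rw [← Real.rpow_lt_rpow_iff hz0.le (by linarith) hk0, ← mul_lt_mul_iff_right₀ hD]; linarith
  have hd0 : 0 < d := by linarith
  rw [(specFun_ratio hk hk0 hb hD hbz.le hzd hzk
    (y := -((1 + k) / k) + coefD m b * d ^ k) (by ring) h2 h3 hx).2] at h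
  by_contra hg
  have hs : 1 < (1 + k) / k := by rw [lt_div_iff₀ hk0]; linarith
  refine absurd h (not_lt.2 (primal_form_nonneg hs hx hx1 (by positivity) (by positivity)
    (by positivity) ?_ (not_lt.1 hg)))
  rw [coefD_eq hk hk0 hb0] at hzk
  have hbk : 0 < b ^ k := by positivity
  field_simp at hzk ⊢
  linarith

lemma lt_weakConst_of_gap_pos (hk : (m : ℝ) = 2 * k) (hk0 : 0 < k)
    (hs3 : (1 + k) / k ≤ 2 ∨ (1 + k) / k = 3) (hx : 0 < x) (hx1 : x ≤ 1)
    (hg : 0 < gap ((1 + k) / k) x) :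
    ENNReal.ofReal (1 / x) < weakConstRestricted (lam m) (specClass m) := by
  have hs : 1 < (1 + k) / k := by rw [lt_div_iff₀ hk0]; linarith
  have hs0 : 0 < (1 + k) / k := by positivity
  have hqs : (1 + 2 * k) / k = 1 + (1 + k) / k := by field_simp; ring
  have ha1 := root_gt hs hs3 (half_lt_of_gap_pos hs hs3 hx hg)
  have ha2 := root_lt_two hs hx hx1
  have hneg := fun Z hZ => primal_form_neg (Z := Z) hs hx rfl ha2 hZ hg
  generalize (1 + (1 + k) / k * x) ^ (1 / ((1 + k) / k)) = a at *
  have ha0 : 1 < a := by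
    have : 0 < 1 / (1 + (1 + k) / k) := by positivity
    linarith
  have ha2' : 0 < 2 - a := by linarith
  have hB1 : 1 < 1 + x / ((1 + k) / k) := by
    have : 0 < x / ((1 + k) / k) := by positivity
    linarith
  have hsB : (1 + k) / k * (1 + x / ((1 + k) / k)) = (1 + k) / k + x := by field_simp
  set B := 1 + x / ((1 + k) / k)
  set Z := (1 + k) / k * a / ((1 + (1 + k) / k) * (2 - a)) with hZ
  have hZ0 : 0 < Z := by positivity
  -- The equality case of Young's inequalities: `u = a`, `w = B`. It gives the value `x` at `d`,
  -- which lies in `(0, 2)`.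
  set b := a ^ k⁻¹ with hb
  set z := Z ^ k⁻¹ with hz
  set d := z * B ^ k⁻¹ with hd
  have hbk : b ^ k = a := Real.rpow_inv_rpow (by linarith) hk0.ne'
  have hzk : z ^ k = Z := Real.rpow_inv_rpow hZ0.le hk0.ne'
  have hz0 : 0 < z := by positivity
  have hb1 : 1 < b := Real.one_lt_rpow ha0 (by positivity)
  have hBr : 1 < B ^ k⁻¹ := Real.one_lt_rpow hB1 (by positivity)
  have hzd : z < d := by rw [hd]; nlinarith
  have hdz : (d / z) ^ k = B := by
    rw [hd, mul_div_cancel_left₀ _ hz0.ne']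
    exact Real.rpow_inv_rpow (by linarith) hk0.ne'
  have hdk : d ^ k = Z * B := by
    rw [hd, Real.mul_rpow hz0.le (by positivity), hzk, Real.rpow_inv_rpow (by linarith) hk0.ne']
  have hDe : coefD m b * a = (1 + (1 + k) / k) * (2 - a) := by
    rw [coefD_eq hk hk0 (by linarith), hbk, hqs]
    have : a ≠ 0 := by linarith
    field_simp
  have hD : 0 < coefD m b := by
    refine pos_of_mul_pos_left (b := a) ?_ (by linarith)
    rw [hDe]; positivity
  have hDz : coefD m b * z ^ k = (1 + k) / k := by
    rw [hzk, hZ, ← hDe]; field_simp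
  have hDd : coefD m b * d ^ k = (1 + k) / k + x := by
    rw [hdk, ← mul_assoc, ← hzk, hDz, hsB]
  -- This is where `a > 1 + 1/(1+s)`, hence `x > 1/2`, is needed.
  have hDb : coefD m b * b ^ k < (1 + k) / k := by
    rw [hbk, hDe]
    have : (1 + (1 + k) / k) * (2 - a) < (1 + (1 + k) / k) * (1 - 1 / (1 + (1 + k) / k)) :=
      mul_lt_mul_of_pos_left (by linarith) (by positivity)
    refine this.trans_eq ?_
    field_simp
    ring
  have hbz : b < z := by
    rw [← Real.rpow_lt_rpow_iff (by linarith) hz0.le hk0, ← mul_lt_mul_iff_right₀ hD]; linarith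
  obtain ⟨hne, hiff⟩ := specFun_ratio hk hk0 hb1 hD hbz.le hzd hDz hDd hx (by linarith) hx
  have hlt := hiff.2 (by rw [hbk, hzk, hdz]; exact hneg Z hZ)
  refine hlt.trans_le ?_
  unfold weakConstRestricted
  refine le_iSup₂_of_le (specFun m b d) ⟨⟨b, d, hb1, hbz.trans hzd, hD, ?_⟩, hne⟩ le_rfl
  rw [hk, show (2 + 2 * k) / (2 * k) = (1 + k) / k by field_simp,
    show 2 * k / 2 = k by ring]
  exact ⟨by linarith, by linarith, by linarith, rfl⟩

end primal

/-! ### Levels exceeded by the second constant -/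

section star

variable {m : ℕ} {k b d z y x : ℝ}

lemma neg_rpow_rpow_exponent (hk0 : 0 < k) (hb : 0 < b) :
    (b ^ (-k)) ^ ((1 + k) / k) = b ^ (-1 - k) := by
  rw [← Real.rpow_mul hb.le]; congr 1; field_simp; ring

lemma rpow_rpow_exponent (hk0 : 0 < k) (hb : 0 < b) :
    (b ^ k) ^ ((1 + k) / k) = (b ^ (-1 - k))⁻¹ := by
  rw [← Real.rpow_mul hb.le, ← Real.rpow_neg hb.le]; congr 1; field_simp; ring

/-- The form is `(N - x (1-d)) / (s b)`. -/
lemma specFunStar_ratio (hk : (m : ℝ) = 2 * k) (hk0 : 0 < k) (hd0 : 0 < d) (hb : b < 1)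
    (hD : 0 < coefDStar m b) (hdz : d < z) (hzb : z ≤ b)
    (hz : coefDStar m b * z ^ (-1 - k) = k / (1 + k))
    (hd : coefDStar m b * d ^ (-1 - k) = k / (1 + k) + y)
    (hy0 : 0 < y) (hy2 : y < 2) (hx : 0 < x) :
    (∫⁻ t in Set.Ici (0 : ℝ), ‖specFunStar m b d t‖ₑ) ≠ 0 ∧
    (ENNReal.ofReal (1 / x) < volume {t : ℝ | 0 ≤ t ∧ 1 ≤ |lamStar m (specFunStar m b d) t|} /
      (∫⁻ t in Set.Ici (0 : ℝ), ‖specFunStar m b d t‖ₑ) ↔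
      2 - (1 + x / ((1 + k) / k)) * (b ^ (-k)) ^ ((1 + k) / k - 1)
      - ((z / b) ^ k) ^ ((1 + k) / k - 1) / ((1 + k) / k) *
        (2 - (((1 + k) / k - 1) * (z / d) ^ k +
          (1 + (1 + k) / k * x) / ((z / d) ^ k) ^ ((1 + k) / k - 1)) / ((1 + k) / k)) < 0) := by
  obtain ⟨N, hN0, hN, hNe⟩ := specFunStar_norm hk hk0 hd0 hb hD hdz hzb hz hd
  have hz0 : 0 < z := by linarith
  have hb0 : 0 < b := by linarith
  have hs : 0 < (1 + k) / k := by positivity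
  have hzd : 0 < z / d := by positivity
  have hzb' : 0 < z / b := by positivity
  refine ⟨by rw [hN]; simpa using hN0, ?_⟩
  rw [hN, lamStar_specFunStar_superlevel hk hk0 hd0 (hdz.trans_le hzb) hb hd hy0 hy2,
    Real.volume_Ioc, ofReal_one_div_lt_div_iff (by linarith) hN0 hx,
    exponent_sub_one hk0, Real.rpow_neg hb0.le, Real.inv_rpow (by positivity),
    Real.rpow_rpow_inv hb0.le hk0.ne',
    Real.rpow_rpow_inv hzb'.le hk0.ne', Real.rpow_rpow_inv hzd.le hk0.ne']
  have hw : (z / d) ^ k = (1 + (1 + k) / k * y) * d / z := by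
    have h1 : ((z / d) ^ k) ^ ((1 + k) / k) = 1 + (1 + k) / k * y := by
      rw [rpow_rpow_exponent hk0 hzd, Real.div_rpow hz0.le hd0.le, inv_div,
        ← mul_div_mul_left _ _ hD.ne', hz, hd]
      field_simp
    rw [rpow_split (by positivity), exponent_sub_one hk0,
      Real.rpow_rpow_inv hzd.le hk0.ne'] at h1
    rw [← h1]; field_simp
  have key : 2 - (1 + x / ((1 + k) / k)) * b⁻¹ - z / b / ((1 + k) / k) *
        (2 - (k⁻¹ * (z / d) ^ k + (1 + (1 + k) / k * x) / (z / d)) / ((1 + k) / k))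
      = (b * ((1 + k) / k))⁻¹ * (N - x * (1 - d)) := by
    rw [hNe, hw]
    field_simp
    ring
  rw [key, ← smul_eq_mul _ (N - _), smul_neg_iff_of_pos_left (by positivity), sub_neg]

lemma gap_pos_of_lt_weakConstStar (hk : (m : ℝ) = 2 * k) (hk0 : 0 < k) (hx : 0 < x) (hx1 : x ≤ 1)
    (h : ENNReal.ofReal (1 / x) < weakConstRestricted (lamStar m) (specClassStar m)) :
    0 < gap ((1 + k) / k) x := by
  unfold weakConstRestricted at h
  simp only [lt_iSup_iff] at h
  obtain ⟨f, ⟨⟨b, d, hd0, hdb, hb, hD, h1, h2, h3, rfl⟩, -⟩, h⟩ := h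
  rw [hk, show 2 * k / (2 + 2 * k) = k / (1 + k) by field_simp,
    show 2 * k / 2 = k by ring] at h1 h2 h3
  have hb0 : 0 < b := by linarith
  have hk1 : -1 - k < 0 := by linarith
  set z : ℝ := (k / (1 + k) / coefDStar m b) ^ (-1 - k)⁻¹ with hz
  have hz0 : 0 < z := by positivity
  have hzk : coefDStar m b * z ^ (-1 - k) = k / (1 + k) := by
    rw [hz, Real.rpow_inv_rpow (by positivity) hk1.ne]; field_simp
  have hzb : z < b := by
    rw [← Real.rpow_lt_rpow_iff_of_neg hb0 hz0 hk1, ← mul_lt_mul_iff_right₀ hD]; linarith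
  have hdz : d < z := by
    rw [← Real.rpow_lt_rpow_iff_of_neg hz0 hd0 hk1, ← mul_lt_mul_iff_right₀ hD]; linarith
  rw [(specFunStar_ratio hk hk0 hd0 hb hD hdz hzb.le hzk
    (y := -(k / (1 + k)) + coefDStar m b * d ^ (-1 - k)) (by ring) h2 h3 hx).2] at h
  by_contra hg
  have hs : 1 < (1 + k) / k := by rw [lt_div_iff₀ hk0]; linarith
  refine absurd h (not_lt.2 (star_form_nonneg hs hx hx1 (by positivity) (by positivity)
    (by positivity) ?_ (not_lt.1 hg)))
  rw [neg_rpow_rpow_exponent hk0 hb0, rpow_rpow_exponent hk0 (by positivity),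
    Real.div_rpow hz0.le hb0.le]
  rw [coefDStar_eq hk hk0 hb0] at hzk
  have hbk : 0 < b ^ (-1 - k) := by positivity
  have hzk0 : 0 < z ^ (-1 - k) := by positivity
  field_simp at hzk ⊢
  linarith

lemma lt_weakConstStar_of_gap_pos (hk : (m : ℝ) = 2 * k) (hk0 : 0 < k)
    (hs3 : (1 + k) / k ≤ 2 ∨ (1 + k) / k = 3) (hx : 0 < x) (hx1 : x ≤ 1)
    (hg : 0 < gap ((1 + k) / k) x) :
    ENNReal.ofReal (1 / x) < weakConstRestricted (lamStar m) (specClassStar m) := by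
  have hs : 1 < (1 + k) / k := by rw [lt_div_iff₀ hk0]; linarith
  have hs0 : 0 < (1 + k) / k := by positivity
  -- Passing to `y ≤ x` only raises the level, since `1/x ≤ 1/y`.
  obtain ⟨y, hy, hyx, hgy, hB2⟩ := exists_gap_pos_rpow_lt_two hs hx hx1 hg
  refine lt_of_le_of_lt (ENNReal.ofReal_le_ofReal (one_div_le_one_div_of_le hy hyx)) ?_
  have hy1 := hyx.trans hx1
  have ha1 := root_gt hs hs3 (half_lt_of_gap_pos hs hs3 hy hgy)
  have ha2 := root_lt_two hs hy hy1
  have hBl := lt_rpow_of_gap_pos hs hs3 hy hy1 hgy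
  have hneg := fun Q hQ hr => star_form_neg (Q := Q) hs hy rfl ha2 hQ hr hgy
  have has : ((1 + (1 + k) / k * y) ^ (1 / ((1 + k) / k))) ^ ((1 + k) / k)
      = 1 + (1 + k) / k * y := by
    rw [one_div, Real.rpow_inv_rpow (by positivity) hs0.ne']
  generalize (1 + (1 + k) / k * y) ^ (1 / ((1 + k) / k)) = a at *
  have ha0 : 1 < a := by
    have : 0 < 1 / (1 + (1 + k) / k) := by positivity
    linarith
  have hB1 : 1 < 1 + y / ((1 + k) / k) := by
    have : 0 < y / ((1 + k) / k) := by positivity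
    linarith
  set B := 1 + y / ((1 + k) / k)
  have hB0 : 0 < B := by linarith
  have hQp : 0 < (1 + (1 + k) / k) * (2 - B ^ ((1 + k) / k)) :=
    mul_pos (by positivity) (by linarith)
  have hQl : (1 + (1 + k) / k) * (2 - B ^ ((1 + k) / k)) ≤ 1 := by
    rw [← le_div_iff₀' (by positivity)]; linarith
  set Q := ((1 + (1 + k) / k) * (2 - B ^ ((1 + k) / k))) ^ ((1 + k) / k)⁻¹ with hQ
  have hQ0 : 0 < Q := by positivity
  have hQs : Q ^ ((1 + k) / k) = (1 + (1 + k) / k) * (2 - B ^ ((1 + k) / k)) :=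
    Real.rpow_inv_rpow hQp.le hs0.ne'
  have hQ1 : Q ≤ 1 := Real.rpow_le_one hQp.le hQl (by positivity)
  -- The equality case `V = B`, `w = a`, with `Q` dictated by the relation for `z`; the value at `d`
  -- is then `y`.
  set b := B ^ (-k)⁻¹ with hb
  set z := b * Q ^ k⁻¹ with hz
  set d := z / a ^ k⁻¹ with hd
  have hb0 : 0 < b := by positivity
  have hz0 : 0 < z := by positivity
  have ha0' : 0 < a ^ k⁻¹ := by positivity
  have hd0 : 0 < d := by positivity
  have hbk : b ^ (-k) = B := Real.rpow_inv_rpow hB0.le (by linarith)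
  have hzbk : (z / b) ^ k = Q := by
    rw [hz, mul_div_cancel_left₀ _ hb0.ne', Real.rpow_inv_rpow hQ0.le hk0.ne']
  have hzdk : (z / d) ^ k = a := by
    have : z / d = a ^ k⁻¹ := by rw [hd]; field_simp
    rw [this, Real.rpow_inv_rpow (by linarith) hk0.ne']
  have hb1 : b < 1 := Real.rpow_lt_one_of_one_lt_of_neg hB1 (by simpa using hk0)
  have hzb : z ≤ b := mul_le_of_le_one_right hb0.le (Real.rpow_le_one hQ0.le hQ1 (by positivity))
  have hdz : d < z := div_lt_self hz0 (Real.one_lt_rpow ha0 (by positivity))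
  have hv := neg_rpow_rpow_exponent hk0 hb0
  rw [hbk] at hv
  have hzv := rpow_rpow_exponent (b := z / b) hk0 (by positivity)
  rw [hzbk, hQs, Real.div_rpow hz0.le hb0.le, inv_div] at hzv
  have hdv := rpow_rpow_exponent (b := z / d) hk0 (by positivity)
  rw [hzdk, has, Real.div_rpow hz0.le hd0.le, inv_div] at hdv
  have hbp : 0 < b ^ (-1 - k) := by positivity
  have hzp : 0 < z ^ (-1 - k) := by positivity
  have hDe := coefDStar_eq hk hk0 hb0
  have hDb : coefDStar m b * b ^ (-1 - k) =
      k / (1 + k) * ((1 + (1 + k) / k) * (2 - B ^ ((1 + k) / k))) := by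
    rw [hDe, hv]; field_simp; ring
  have hD : 0 < coefDStar m b := by
    refine pos_of_mul_pos_left (b := b ^ (-1 - k)) ?_ hbp.le
    rw [hDb]; positivity
  have hDz : coefDStar m b * z ^ (-1 - k) = k / (1 + k) := by
    have h1 : coefDStar m b * z ^ (-1 - k) * (b ^ (-1 - k) / z ^ (-1 - k))
        = k / (1 + k) * (b ^ (-1 - k) / z ^ (-1 - k)) := by
      rw [← hzv, ← hDb, hzv]; field_simp
    exact mul_right_cancel₀ (by positivity) h1
  have hDd : coefDStar m b * d ^ (-1 - k) = k / (1 + k) + y := by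
    have h1 : d ^ (-1 - k) = (1 + (1 + k) / k * y) * z ^ (-1 - k) := by
      rw [hdv]; field_simp
    rw [h1, mul_left_comm, hDz]; field_simp
  obtain ⟨hne, hiff⟩ := specFunStar_ratio hk hk0 hd0 hb1 hD hdz hzb hDz hDd hy (by linarith) hy
  have hlt := hiff.2 (by rw [hbk, hzbk, hzdk]; exact hneg Q hQ0 hQs)
  refine hlt.trans_le ?_
  have hQl' : (1 + (1 + k) / k) * (2 - B ^ ((1 + k) / k)) < 1 := by
    rw [← lt_div_iff₀' (by positivity)]; linarith
  have hDb' : coefDStar m b * b ^ (-1 - k) < k / (1 + k) * 1 := by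
    rw [hDb]; exact mul_lt_mul_of_pos_left hQl' (by positivity)
  unfold weakConstRestricted
  refine le_iSup₂_of_le (specFunStar m b d)
    ⟨⟨b, d, hd0, hdz.trans_le hzb, hb1, hD, ?_⟩, hne⟩ le_rfl
  rw [hk, show 2 * k / (2 + 2 * k) = k / (1 + k) by field_simp,
    show 2 * k / 2 = k by ring]
  exact ⟨by linarith, by linarith, by linarith, rfl⟩

end star

/-! ### Comparison of the two constants -/

lemma le_of_forall_ofReal_one_div_lt {W W' : ENNReal} (h1 : ENNReal.ofReal (1 / 1) < W')
    (h : ∀ x : ℝ, 0 < x → x ≤ 1 → ENNReal.ofReal (1 / x) < W → ENNReal.ofReal (1 / x) < W') :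
    W ≤ W' := by
  refine le_of_forall_lt fun c hc => ?_
  have hcr : c = ENNReal.ofReal c.toReal := (ENNReal.ofReal_toReal hc.ne_top).symm
  rcases le_or_gt c.toReal 1 with hr | hr
  · rw [hcr]
    exact (ENNReal.ofReal_le_ofReal (by simpa using hr)).trans_lt h1
  · have := h (1 / c.toReal) (by positivity) (by rw [div_le_one (by linarith)]; exact hr.le)
    rw [one_div_one_div, ← hcr] at this
    exact this hc

theorem mainTheorem3 (m : ℕ) (hm : 1 ≤ m) :
    weakConstRestricted (lamStar m) (specClassStar m) =
      weakConstRestricted (lam m) (specClass m) := by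
  obtain ⟨k, hk⟩ : ∃ k : ℝ, (m : ℝ) = 2 * k := ⟨m / 2, by ring⟩
  have hm' : (1 : ℝ) ≤ m := by exact_mod_cast hm
  have hk0 : 0 < k := by linarith
  have hs : 1 < (1 + k) / k := by rw [lt_div_iff₀ hk0]; linarith
  -- Here `s = 1 + 2/m`, so only `m = 1` gives an exponent above 2.
  have hs3 : (1 + k) / k ≤ 2 ∨ (1 + k) / k = 3 := by
    rcases hm.eq_or_lt with rfl | h2
    · right
      have : k = 1 / 2 := by push_cast at hk; linarith
      rw [this]; norm_num
    · left
      have : (2 : ℝ) ≤ m := by exact_mod_cast h2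
      rw [div_le_iff₀ hk0]; linarith
  refine le_antisymm (le_of_forall_ofReal_one_div_lt
    (lt_weakConst_of_gap_pos hk hk0 hs3 one_pos le_rfl (gap_one_pos hs)) fun x hx hx1 h =>
      lt_weakConst_of_gap_pos hk hk0 hs3 hx hx1 (gap_pos_of_lt_weakConstStar hk hk0 hx hx1 h))
    (le_of_forall_ofReal_one_div_lt
    (lt_weakConstStar_of_gap_pos hk hk0 hs3 one_pos le_rfl (gap_one_pos hs)) fun x hx hx1 h =>
      lt_weakConstStar_of_gap_pos hk hk0 hs3 hx hx1 (gap_pos_of_lt_weakConst hk hk0 hx hx1 h))
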